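/- Let $n\ge 1$ be an integer, let $\kappa,\lambda>0$ and $a<b$ be real numbers, and let $(W_s)_{s\in(a,b)}$ be a family of measurable, radially symmetric functions $W_s:\mathbb R^n\to[0,\infty)$ that vanish at infinity, i.e. $W_s(x)\to 0$ as $|x|\to\infty$ for each $s$. Assume that $$\text{(i)}\quad \limsup_{s\to b^-}\|W_s\|_{L^\infty(\mathbb R^n)}=\kappa,\qquad \text{(ii)}\quad W_s\to\kappa \text{ locally uniformly on } \mathbb R^n \text{ as } s\to b^- .$$ Let $H^1_r(\mathbb R^n)$ denote the space of real-valued radially symmetric functions in $H^1(\mathbb R^n)$. For $s\in(a,b)$ with $W_s$ essentially bounded (by (i), this holds for all $s$ close enough to $b$) let $$L_s:H^1_r(\mathbb R^n)\to H^1_r(\mathbb R^n),\qquad L_s\phi=(-\Delta+\lambda)^{-1}(W_s\phi),$$ where $(-\Delta+\lambda)^{-1}g$ is the unique $u\in H^1(\mathbb R^n)$ with $\int\nabla u\cdot\nabla v+\lambda uv=\int gv$ for all $v\in H^1(\mathbb R^n)$. This operator is compact, nonnegative, and self-adjoint for the inner product $\int\nabla u\cdot\nabla v+\lambda uv$. Let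 $\mu_0(s)\ge\mu_1(s)\ge\mu_2(s)\ge\dots\ge0$ be its eigenvalues in decreasing order, counted with multiplicity (with $\mu_k(s)=0$ if there are at most $k$ positive ones). Then, for every $k\in\{0,1,2,\dots\}$, $$\mu_k(s)\to\frac{\kappa}{\lambda}\qquad\text{as } s\to b^- .$$ -/

import Mathlib

open MeasureTheory Filter Topology
open scoped ENNReal ContDiff RealInnerProductSpace

noncomputable section

namespace RadialSchrodinger

/-- Euclidean space `ℝⁿ`. -/
abbrev Eucl (n : ℕ) := EuclideanSpace ℝ (Fin n)

/-- Real-valued `L²(ℝⁿ)`. -/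
abbrev L2 (n : ℕ) := Lp ℝ 2 (volume : Measure (Eucl n))

/-- Vector fields of class `L²(ℝⁿ; ℝⁿ)`. -/
abbrev L2Vec (n : ℕ) := Lp (Eucl n) 2 (volume : Measure (Eucl n))

/-- `G` is the weak gradient of `u`: for every real test function `φ` and every direction `v`,
`∫ u ∂ᵥφ = - ∫ ⟨G, v⟩ φ`. -/
def IsWeakGradient {n : ℕ} (u : Eucl n → ℝ) (G : Eucl n → Eucl n) : Prop :=
  ∀ φ : Eucl n → ℝ, ContDiff ℝ ∞ φ → HasCompactSupport φ → ∀ v : Eucl n,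
    ∫ x, u x * fderiv ℝ φ x v = - ∫ x, ⟪G x, v⟫ * φ x

lemma memLp_fderiv {n : ℕ} {φ : Eucl n → ℝ} (h : ContDiff ℝ ∞ φ) (hc : HasCompactSupport φ)
    (v : Eucl n) : MemLp (fun x => fderiv ℝ φ x v) 2 volume := by
  have h1 : Continuous (fun x => fderiv ℝ φ x v) :=
    (h.continuous_fderiv (by simp)).clm_apply continuous_const
  exact h1.memLp_of_hasCompactSupport (hc.fderiv_apply ℝ v)

lemma memLp_smul_const {n : ℕ} {φ : Eucl n → ℝ} (h : ContDiff ℝ ∞ φ) (hc : HasCompactSupport φ)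
    (v : Eucl n) : MemLp (fun x => φ x • v) 2 volume :=
  (h.continuous.smul continuous_const).memLp_of_hasCompactSupport (hc.smul_right)

lemma inner_fderiv {n : ℕ} {φ : Eucl n → ℝ} (h : ContDiff ℝ ∞ φ) (hc : HasCompactSupport φ)
    (v : Eucl n) (u : L2 n) :
    ⟪u, (memLp_fderiv h hc v).toLp _⟫ = ∫ x, u x * fderiv ℝ φ x v := by
  rw [L2.inner_def]
  refine integral_congr_ae ?_
  filter_upwards [(memLp_fderiv h hc v).coeFn_toLp] with x hx
  rw [hx]
  simp [mul_comm]

lemma inner_smul_const {n : ℕ} {φ : Eucl n → ℝ} (h : ContDiff ℝ ∞ φ) (hc : HasCompactSupport φ)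
    (v : Eucl n) (G : L2Vec n) :
    ⟪G, (memLp_smul_const h hc v).toLp _⟫ = ∫ x, ⟪G x, v⟫ * φ x := by
  rw [L2.inner_def]
  refine integral_congr_ae ?_
  filter_upwards [(memLp_smul_const h hc v).coeFn_toLp] with x hx
  rw [hx, real_inner_smul_right, mul_comm]

lemma isWeakGradient_iff {n : ℕ} (u : L2 n) (G : L2Vec n) :
    IsWeakGradient u G ↔ ∀ (φ : Eucl n → ℝ) (h : ContDiff ℝ ∞ φ) (hc : HasCompactSupport φ)
      (v : Eucl n), ⟪u, (memLp_fderiv h hc v).toLp _⟫ +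
        ⟪G, (memLp_smul_const h hc v).toLp _⟫ = 0 := by
  constructor
  · intro H φ h hc v
    rw [inner_fderiv h hc v u, inner_smul_const h hc v G, H φ h hc v, neg_add_cancel]
  · intro H φ h hc v
    have := H φ h hc v
    rw [inner_fderiv h hc v u, inner_smul_const h hc v G] at this
    exact eq_neg_of_add_eq_zero_left this

/-- The Sobolev space `H¹(ℝⁿ)`, realised as the space of pairs `(u, ∇u) ∈ L² × L²` in which
the second component is the weak gradient of the first one; its Hilbert space norm is
`(‖u‖₂² + ‖∇u‖₂²)^{1/2}`. -/
def H1Submodule (n : ℕ) : Submodule ℝ (WithLp 2 (L2 n × L2Vec n)) where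
  carrier := {p | IsWeakGradient (p.fst : Eucl n → ℝ) (p.snd : Eucl n → Eucl n)}
  zero_mem' := by
    simp only [Set.mem_ofPred_eq, isWeakGradient_iff]
    intro φ h hc v
    simp
  add_mem' := by
    intro p q hp hq
    simp only [Set.mem_ofPred_eq, isWeakGradient_iff] at hp hq ⊢
    intro φ h hc v
    have e1 := hp φ h hc v
    have e2 := hq φ h hc v
    simp only [WithLp.add_fst, WithLp.add_snd, inner_add_left]
    linarith
  smul_mem' := by
    intro c p hp
    simp only [Set.mem_ofPred_eq, isWeakGradient_iff] at hp ⊢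
    intro φ h hc v
    have e1 := hp φ h hc v
    simp only [WithLp.smul_fst, WithLp.smul_snd, real_inner_smul_left]
    rw [← mul_add, e1, mul_zero]

lemma mem_H1Submodule {n : ℕ} {p : WithLp 2 (L2 n × L2Vec n)} :
    p ∈ H1Submodule n ↔ IsWeakGradient (p.fst : Eucl n → ℝ) (p.snd : Eucl n → Eucl n) := Iff.rfl

lemma isClosed_H1Submodule (n : ℕ) : IsClosed (H1Submodule n : Set (WithLp 2 (L2 n × L2Vec n))) := by
  have : (H1Submodule n : Set (WithLp 2 (L2 n × L2Vec n))) =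
      ⋂ (φ : Eucl n → ℝ) (h : ContDiff ℝ ∞ φ) (hc : HasCompactSupport φ) (v : Eucl n),
        {p | ⟪p.fst, (memLp_fderiv h hc v).toLp _⟫ +
          ⟪p.snd, (memLp_smul_const h hc v).toLp _⟫ = 0} := by
    ext p
    simp only [SetLike.mem_coe, mem_H1Submodule, isWeakGradient_iff, Set.mem_iInter, Set.mem_ofPred_eq]
  rw [this]
  refine isClosed_iInter fun φ => isClosed_iInter fun h => isClosed_iInter fun hc =>
    isClosed_iInter fun v => isClosed_eq ?_ continuous_const
  have c1 : Continuous fun p : WithLp 2 (L2 n × L2Vec n) => p.fst :=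
    (WithLp.fstL 2 ℝ (L2 n) (L2Vec n)).continuous
  have c2 : Continuous fun p : WithLp 2 (L2 n × L2Vec n) => p.snd :=
    (WithLp.sndL 2 ℝ (L2 n) (L2Vec n)).continuous
  exact (c1.inner continuous_const).add (c2.inner continuous_const)

/-- The Hilbert space `H¹(ℝⁿ)`. -/
def H1 (n : ℕ) : Type := ↥(H1Submodule n)

instance (n : ℕ) : NormedAddCommGroup (H1 n) := inferInstanceAs (NormedAddCommGroup (H1Submodule n))

instance (n : ℕ) : InnerProductSpace ℝ (H1 n) :=
  inferInstanceAs (InnerProductSpace ℝ (H1Submodule n))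

instance (n : ℕ) : CompleteSpace (H1 n) := (isClosed_H1Submodule n).completeSpace_coe

/-- The pair `(u, ∇u)` of an element of `H¹(ℝⁿ)`. -/
def toPair (n : ℕ) : H1 n →L[ℝ] WithLp 2 (L2 n × L2Vec n) := (H1Submodule n).subtypeL

/-- The embedding `H¹(ℝⁿ) → L²(ℝⁿ)`, `u ↦ u`. -/
def toL2 (n : ℕ) : H1 n →L[ℝ] L2 n := (WithLp.fstL 2 ℝ (L2 n) (L2Vec n)).comp (toPair n)

/-- The weak gradient `H¹(ℝⁿ) → L²(ℝⁿ; ℝⁿ)`, `u ↦ ∇u`. -/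
def grad (n : ℕ) : H1 n →L[ℝ] L2Vec n := (WithLp.sndL 2 ℝ (L2 n) (L2Vec n)).comp (toPair n)

lemma isWeakGradient_grad {n : ℕ} (u : H1 n) : IsWeakGradient (toL2 n u) (grad n u) := u.2

lemma exists_H1_of_isWeakGradient {n : ℕ} (u : L2 n) (G : L2Vec n) (h : IsWeakGradient u G) :
    ∃ w : H1 n, toL2 n w = u ∧ grad n w = G := ⟨⟨WithLp.toLp 2 (u, G), h⟩, rfl, rfl⟩

/-- The bilinear form `(u, v) ↦ ∫ ∇u · ∇v + λ u v` of `-Δ + λ` on `H¹(ℝⁿ)`. -/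
def energyForm (n : ℕ) (lam : ℝ) : H1 n →L[ℝ] H1 n →L[ℝ] ℝ :=
  ((innerSL ℝ : L2Vec n →L[ℝ] L2Vec n →L[ℝ] ℝ).bilinearComp (grad n) (grad n)) +
    lam • ((innerSL ℝ : L2 n →L[ℝ] L2 n →L[ℝ] ℝ).bilinearComp (toL2 n) (toL2 n))

lemma energyForm_apply {n : ℕ} {lam : ℝ} (u v : H1 n) :
    energyForm n lam u v = ⟪grad n u, grad n v⟫ + lam * ⟪toL2 n u, toL2 n v⟫ := rfl

lemma norm_sq_H1 {n : ℕ} (u : H1 n) : ‖u‖ ^ 2 = ‖toL2 n u‖ ^ 2 + ‖grad n u‖ ^ 2 :=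
  WithLp.prod_norm_sq_eq_of_L2 (toPair n u)

lemma isCoercive_energyForm (n : ℕ) {lam : ℝ} (hlam : 0 < lam) :
    IsCoercive (energyForm n lam) := by
  refine ⟨min 1 lam, lt_min one_pos hlam, fun u => ?_⟩
  rw [energyForm_apply, real_inner_self_eq_norm_sq, real_inner_self_eq_norm_sq, mul_assoc,
    ← pow_two, norm_sq_H1 u]
  nlinarith [min_le_left 1 lam, min_le_right 1 lam, sq_nonneg ‖toL2 n u‖, sq_nonneg ‖grad n u‖]

/-- The operator `(-Δ + λ)⁻¹ : L²(ℝⁿ) → H¹(ℝⁿ)`, `λ > 0`. By `energyForm_resolvent` and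
`eq_resolvent` below, `(-Δ + λ)⁻¹ g` is the unique `u ∈ H¹(ℝⁿ)` such that
`∫ ∇u · ∇v + λ u v = ∫ g v` for all `v ∈ H¹(ℝⁿ)`. -/
def resolvent (n : ℕ) {lam : ℝ} (hlam : 0 < lam) : L2 n →L[ℝ] H1 n :=
  ((isCoercive_energyForm n hlam).continuousLinearEquivOfBilin.symm : H1 n →L[ℝ] H1 n).comp
    (ContinuousLinearMap.adjoint (toL2 n))

lemma energyForm_resolvent {n : ℕ} {lam : ℝ} (hlam : 0 < lam) (g : L2 n) (v : H1 n) :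
    energyForm n lam (resolvent n hlam g) v = ⟪g, toL2 n v⟫ := by
  rw [← (isCoercive_energyForm n hlam).continuousLinearEquivOfBilin_apply]
  simp [resolvent, ContinuousLinearMap.adjoint_inner_left]

lemma eq_resolvent {n : ℕ} {lam : ℝ} (hlam : 0 < lam) {g : L2 n} {u : H1 n}
    (h : ∀ v : H1 n, energyForm n lam u v = ⟪g, toL2 n v⟫) : u = resolvent n hlam g := by
  have key : energyForm n lam (u - resolvent n hlam g) (u - resolvent n hlam g) = 0 := by
    set w := u - resolvent n hlam g with hw
    have e : energyForm n lam w w =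
        energyForm n lam u w - energyForm n lam (resolvent n hlam g) w := by
      conv_lhs => rw [show energyForm n lam w = energyForm n lam u -
        energyForm n lam (resolvent n hlam g) from map_sub (energyForm n lam) _ _]
      rfl
    rw [e, h w, energyForm_resolvent hlam g w, sub_self]
  obtain ⟨C, hC, hb⟩ := isCoercive_energyForm n hlam
  have h1 := hb (u - resolvent n hlam g)
  rw [key] at h1
  have h2 : ‖u - resolvent n hlam g‖ = 0 := by
    by_contra hne
    have : 0 < ‖u - resolvent n hlam g‖ := lt_of_le_of_ne (norm_nonneg _) (Ne.symm hne)
    have : 0 < C * ‖u - resolvent n hlam g‖ * ‖u - resolvent n hlam g‖ := by positivity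
    linarith
  exact sub_eq_zero.mp (norm_eq_zero.mp h2)

/-- Multiplication by an essentially bounded potential, `L²(ℝⁿ) → L²(ℝⁿ)`, `φ ↦ W φ`. -/
def mulPotential {n : ℕ} (W : Eucl n → ℝ) (hW : MemLp W ∞ volume) : L2 n →L[ℝ] L2 n :=
  (ContinuousLinearMap.mul ℝ ℝ).holderL volume ∞ 2 2 (hW.toLp W)

lemma mulPotential_ae {n : ℕ} (W : Eucl n → ℝ) (hW : MemLp W ∞ volume) (f : L2 n) :
    mulPotential W hW f =ᵐ[volume] fun x => W x * f x := by
  filter_upwards [(ContinuousLinearMap.mul ℝ ℝ).coeFn_holder (r := 2) (hW.toLp W) f,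
    hW.coeFn_toLp] with x h1 h2
  exact h1.trans (by rw [h2]; rfl)

/-- A function on `ℝⁿ` is radially symmetric if it only depends on `|x|`. -/
def IsRadial {n : ℕ} (W : Eucl n → ℝ) : Prop := ∀ x y, ‖x‖ = ‖y‖ → W x = W y

/-- Radial symmetry for functions that are defined up to null sets: invariance under all
linear isometries (the elements of `O(n)`). -/
def IsRadialAE {n : ℕ} (u : Eucl n → ℝ) : Prop :=
  ∀ R : Eucl n ≃ₗᵢ[ℝ] Eucl n, u ∘ R =ᵐ[volume] u

/-- The space `H¹ᵣ(ℝⁿ)` of radially symmetric functions in `H¹(ℝⁿ)`. -/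
def H1r (n : ℕ) : Submodule ℝ (H1 n) where
  carrier := {u | IsRadialAE (toL2 n u)}
  zero_mem' := by
    intro R
    have h0 : (toL2 n 0 : Eucl n → ℝ) =ᵐ[volume] 0 := by
      rw [map_zero]; exact Lp.coeFn_zero _ _ _
    exact (R.measurePreserving.quasiMeasurePreserving.ae_eq_comp h0).trans h0.symm
  add_mem' := by
    intro u v hu hv R
    have h0 : (toL2 n (u + v) : Eucl n → ℝ) =ᵐ[volume] toL2 n u + toL2 n v := by
      rw [map_add]; exact Lp.coeFn_add _ _
    exact (R.measurePreserving.quasiMeasurePreserving.ae_eq_comp h0).trans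
      (((hu R).add (hv R)).trans h0.symm)
  smul_mem' := by
    intro c u hu R
    have h0 : (toL2 n (c • u) : Eucl n → ℝ) =ᵐ[volume] c • (toL2 n u : Eucl n → ℝ) := by
      rw [map_smul]; exact Lp.coeFn_smul _ _
    exact (R.measurePreserving.quasiMeasurePreserving.ae_eq_comp h0).trans
      (((hu R).const_smul c).trans h0.symm)

/-- The pair `(u ∘ R, R⁻¹ ∘ ∇u ∘ R)` for a linear isometry `R`. -/
def rotPair {n : ℕ} (R : Eucl n ≃ₗᵢ[ℝ] Eucl n) (p : WithLp 2 (L2 n × L2Vec n)) :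
    WithLp 2 (L2 n × L2Vec n) :=
  WithLp.toLp 2 (Lp.compMeasurePreserving R R.measurePreserving p.fst,
    (R.symm.toContinuousLinearEquiv : Eucl n →L[ℝ] Eucl n).compLp
      (Lp.compMeasurePreserving R R.measurePreserving p.snd))

lemma rotPair_fst {n : ℕ} (R : Eucl n ≃ₗᵢ[ℝ] Eucl n) (p : WithLp 2 (L2 n × L2Vec n)) :
    (rotPair R p).fst =ᵐ[volume] p.fst ∘ R :=
  Lp.coeFn_compMeasurePreserving _ _

lemma rotPair_snd {n : ℕ} (R : Eucl n ≃ₗᵢ[ℝ] Eucl n) (p : WithLp 2 (L2 n × L2Vec n)) :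
    (rotPair R p).snd =ᵐ[volume] fun x => R.symm (p.snd (R x)) := by
  filter_upwards [ContinuousLinearMap.coeFn_compLp
      (R.symm.toContinuousLinearEquiv : Eucl n →L[ℝ] Eucl n)
      (Lp.compMeasurePreserving R R.measurePreserving p.snd),
    Lp.coeFn_compMeasurePreserving p.snd R.measurePreserving] with x h1 h2
  exact h1.trans (by rw [h2]; rfl)

lemma integral_comp_isometry {n : ℕ} (R : Eucl n ≃ₗᵢ[ℝ] Eucl n) (f : Eucl n → ℝ) :
    ∫ x, f (R x) = ∫ x, f x :=
  R.measurePreserving.integral_comp R.toHomeomorph.measurableEmbedding f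

lemma rotPair_mem {n : ℕ} (R : Eucl n ≃ₗᵢ[ℝ] Eucl n) {p : WithLp 2 (L2 n × L2Vec n)}
    (hp : p ∈ H1Submodule n) : rotPair R p ∈ H1Submodule n := by
  intro φ h hc v
  have hR : ContDiff ℝ ∞ (φ ∘ R.symm) := h.comp R.symm.contDiff
  have hRc : HasCompactSupport (φ ∘ R.symm) := hc.comp_homeomorph R.symm.toHomeomorph
  have key := hp (φ ∘ R.symm) hR hRc (R v)
  have e1 : ∫ x, (rotPair R p).fst x * fderiv ℝ φ x v =
      ∫ x, p.fst x * fderiv ℝ (φ ∘ R.symm) x (R v) := by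
    rw [← integral_comp_isometry R (fun x => p.fst x * fderiv ℝ (φ ∘ R.symm) x (R v))]
    refine integral_congr_ae ?_
    filter_upwards [rotPair_fst R p] with x hx
    have hd : fderiv ℝ (φ ∘ R.symm) (R x) (R v) = fderiv ℝ φ x v := by
      have hφ : DifferentiableAt ℝ φ (R.symm (R x)) := (h.differentiable (by simp)) _
      have := (hφ.hasFDerivAt.comp (R x)
        (R.symm.toContinuousLinearEquiv : Eucl n →L[ℝ] Eucl n).hasFDerivAt).fderiv
      have h2 := congrArg (fun T : Eucl n →L[ℝ] ℝ => T (R v)) this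
      simpa using h2
    rw [hx, hd]
    rfl
  have e2 : ∫ x, ⟪(rotPair R p).snd x, v⟫ * φ x =
      ∫ x, ⟪p.snd x, R v⟫ * (φ ∘ R.symm) x := by
    rw [← integral_comp_isometry R (fun x => ⟪p.snd x, R v⟫ * (φ ∘ R.symm) x)]
    refine integral_congr_ae ?_
    filter_upwards [rotPair_snd R p] with x hx
    have hi : ⟪R.symm (p.snd (R x)), v⟫ = ⟪p.snd (R x), R v⟫ := by
      rw [← R.inner_map_map, R.apply_symm_apply]
    rw [hx, hi]
    simp
  rw [e1, e2]
  exact key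

/-- The rotated function `u ∘ R` for `u ∈ H¹(ℝⁿ)` and a linear isometry `R`. -/
def rot {n : ℕ} (R : Eucl n ≃ₗᵢ[ℝ] Eucl n) (u : H1 n) : H1 n :=
  ⟨rotPair R (toPair n u), rotPair_mem R u.2⟩

lemma toL2_rot {n : ℕ} (R : Eucl n ≃ₗᵢ[ℝ] Eucl n) (u : H1 n) :
    toL2 n (rot R u) =ᵐ[volume] toL2 n u ∘ R := rotPair_fst R (toPair n u)

lemma grad_rot {n : ℕ} (R : Eucl n ≃ₗᵢ[ℝ] Eucl n) (u : H1 n) :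
    grad n (rot R u) =ᵐ[volume] fun x => R.symm (grad n u (R x)) := rotPair_snd R (toPair n u)

lemma inner_grad_rot {n : ℕ} (R : Eucl n ≃ₗᵢ[ℝ] Eucl n) (u v : H1 n) :
    ⟪grad n (rot R u), grad n v⟫ = ⟪grad n u, grad n (rot R.symm v)⟫ := by
  refine (L2.inner_def (𝕜 := ℝ) _ _).trans (Eq.trans ?_ (L2.inner_def (𝕜 := ℝ) _ _).symm)
  refine Eq.trans ?_ (integral_comp_isometry R _)
  refine integral_congr_ae ?_
  filter_upwards [grad_rot R u, R.measurePreserving.quasiMeasurePreserving.ae_eq_comp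
    (grad_rot R.symm v)] with x h1 h2
  simp only [Function.comp_apply, LinearIsometryEquiv.symm_symm,
    LinearIsometryEquiv.symm_apply_apply] at h2
  rw [h1, h2, ← R.inner_map_map, R.apply_symm_apply]

lemma inner_toL2_rot {n : ℕ} (R : Eucl n ≃ₗᵢ[ℝ] Eucl n) (g : L2 n) (hg : g ∘ R =ᵐ[volume] g)
    (v : H1 n) : ⟪g, toL2 n (rot R.symm v)⟫ = ⟪g, toL2 n v⟫ := by
  refine (L2.inner_def (𝕜 := ℝ) _ _).trans (Eq.trans ?_ (L2.inner_def (𝕜 := ℝ) _ _).symm)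
  refine Eq.trans (integral_comp_isometry R _).symm ?_
  refine integral_congr_ae ?_
  filter_upwards [hg, R.measurePreserving.quasiMeasurePreserving.ae_eq_comp
    (toL2_rot R.symm v)] with x h1 h2
  simp only [Function.comp_apply, LinearIsometryEquiv.symm_apply_apply] at h1 h2
  rw [h1, h2]

lemma inner_rot_toL2 {n : ℕ} (R : Eucl n ≃ₗᵢ[ℝ] Eucl n) (u v : H1 n) :
    ⟪toL2 n (rot R u), toL2 n v⟫ = ⟪toL2 n u, toL2 n (rot R.symm v)⟫ := by
  refine (L2.inner_def (𝕜 := ℝ) _ _).trans (Eq.trans ?_ (L2.inner_def (𝕜 := ℝ) _ _).symm)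
  refine Eq.trans ?_ (integral_comp_isometry R _)
  refine integral_congr_ae ?_
  filter_upwards [toL2_rot R u, R.measurePreserving.quasiMeasurePreserving.ae_eq_comp
    (toL2_rot R.symm v)] with x h1 h2
  simp only [Function.comp_apply, LinearIsometryEquiv.symm_apply_apply] at h1 h2
  rw [h1, h2]

lemma energyForm_rot {n : ℕ} {lam : ℝ} (R : Eucl n ≃ₗᵢ[ℝ] Eucl n) (u v : H1 n) :
    energyForm n lam (rot R u) v = energyForm n lam u (rot R.symm v) := by
  rw [energyForm_apply, energyForm_apply, inner_grad_rot, inner_rot_toL2]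

/-- `(-Δ + λ)⁻¹` maps radially symmetric functions to radially symmetric functions. -/
lemma resolvent_mem_H1r {n : ℕ} {lam : ℝ} (hlam : 0 < lam) {g : L2 n} (hg : IsRadialAE g) :
    resolvent n hlam g ∈ H1r n := by
  intro R
  have hrot : rot R (resolvent n hlam g) = resolvent n hlam g := by
    refine eq_resolvent hlam fun v => ?_
    rw [energyForm_rot, energyForm_resolvent, inner_toL2_rot R g (hg R)]
  have h1 := toL2_rot R (resolvent n hlam g)
  rw [hrot] at h1
  exact h1.symm

lemma isRadialAE_mulPotential {n : ℕ} {W : Eucl n → ℝ} (hW : MemLp W ∞ volume)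
    (hr : IsRadial W) {f : L2 n} (hf : IsRadialAE f) : IsRadialAE (mulPotential W hW f) := by
  intro R
  filter_upwards [R.measurePreserving.quasiMeasurePreserving.ae_eq_comp (mulPotential_ae W hW f),
    mulPotential_ae W hW f, hf R] with x h1 h2 h3
  rw [h1, h2, Function.comp_apply, hr (R x) x (R.norm_map x)]
  exact congrArg (W x * ·) h3

open Classical in
/-- The operator `L : H¹ᵣ(ℝⁿ) → H¹ᵣ(ℝⁿ)`, `L φ = (-Δ + λ)⁻¹ (W φ)`, for an essentially bounded
radially symmetric potential `W` (and, by convention, `0` for any other `W`). -/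
def potentialOp (n : ℕ) {lam : ℝ} (hlam : 0 < lam) (W : Eucl n → ℝ) : H1r n →L[ℝ] H1r n :=
  if h : MemLp W ∞ volume ∧ IsRadial W then
    (((resolvent n hlam).comp ((mulPotential W h.1).comp (toL2 n))).comp
      (H1r n).subtypeL).codRestrict (H1r n)
        fun φ => resolvent_mem_H1r hlam (isRadialAE_mulPotential h.1 h.2 φ.2)
  else 0

/-- The `k`-th eigenvalue, `k = 0, 1, 2, …`, of a compact self-adjoint nonnegative operator `T` on
an infinite-dimensional space, in decreasing order and counted with multiplicity: the largest `μ`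
such that the eigenspaces for eigenvalues `≥ μ` together have dimension at least `k + 1`. -/
def kthEigenvalue {V : Type*} [AddCommGroup V] [Module ℝ V] (T : Module.End ℝ V) (k : ℕ) : ℝ :=
  sSup {μ : ℝ | ((k + 1 : ℕ) : Cardinal) ≤
    Module.rank ℝ ↥(⨆ ν ∈ Set.Ici μ, Module.End.eigenspace T ν)}

end RadialSchrodinger

end

noncomputable section

namespace RadialSchrodinger

/-! ### Variational principle for a coercive symmetric form -/

section Spectral

variable {V : Type*} [NormedAddCommGroup V] [NormedSpace ℝ V]

/-! Put `a(u, v) = ∫ ∇u·∇v + λuv`. Testing the equation for `L_s u` against `u` gives `a(L_s u, u) =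
∫ W_s u²`, so the eigenvalues are governed by the Rayleigh quotient `∫ W_s u² / ∫ (|∇u|² + λu²)`.
For `s` near `b`, `W_s ≤ κ + ε` almost everywhere, so the quotient never exceeds `(κ + ε)/λ`, and
neither does any eigenvalue.

For the lower bound it is enough to have a `(k+1)`-dimensional space of radial functions, supported
in one fixed ball, with `∫ |∇u|² ≤ ε ∫ u²`. On that ball `W_s ≥ κ - ε` for `s` near `b`, so the
quotient is at least `(κ - ε)/(λ + ε)` on the whole space, and by the min-max principle `μ_k(s)` is
at least that too. Letting `ε → 0` gives the limit. The space (`exists_radial_subspace`) is spanned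
by widely dilated copies of one annular bump: dilation makes the Dirichlet energy small relative to
the mass, and dyadic scales make the supports disjoint, so both quadratic forms are diagonal.

Two general facts support this. The min-max bounds (`kthEigenvalue_mem_Icc`) are proved directly for
a coercive symmetric form by maximising the Rayleigh quotient on the orthogonal complement of the
eigenspaces already counted. Maximisers exist because `L_s` is compact. Its compactness comes from a
local Rellich theorem (`isCompactOperator_cutoff_toL2`) together with the decay of `W_s` at
infinity. Rellich itself is obtained by approximating the restriction to a ball, in operator norm,
by finite-rank local averages, with the error controlled by the translation estimate
`norm_translate_sub_le`. -/

lemma exists_abs_form_le {a : V →L[ℝ] V →L[ℝ] ℝ} (ha : IsCoercive a) (T : V →L[ℝ] V) :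
    ∃ K : ℝ, 0 ≤ K ∧ ∀ u, |a (T u) u| ≤ K * a u u := by
  obtain ⟨C, hC, hb⟩ := ha
  refine ⟨‖a‖ * ‖T‖ / C, by positivity, fun u => ?_⟩
  have h1 : |a (T u) u| ≤ ‖a‖ * (‖T‖ * ‖u‖) * ‖u‖ :=
    (a.le_opNorm₂ (T u) u).trans (by gcongr; exact T.le_opNorm u)
  have h2 := hb u
  calc |a (T u) u| ≤ ‖a‖ * (‖T‖ * ‖u‖) * ‖u‖ := h1
    _ = ‖a‖ * ‖T‖ / C * (C * ‖u‖ * ‖u‖) := by field_simp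
    _ ≤ _ := by gcongr

lemma form_self_pos {a : V →L[ℝ] V →L[ℝ] ℝ} (ha : IsCoercive a) {u : V} (hu : u ≠ 0) :
    0 < a u u := by
  obtain ⟨C, hC, hb⟩ := ha
  have := norm_pos_iff.mpr hu
  exact lt_of_lt_of_le (by positivity) (hb u)

lemma form_self_nonneg {a : V →L[ℝ] V →L[ℝ] ℝ} (ha : IsCoercive a) (u : V) : 0 ≤ a u u := by
  obtain ⟨C, hC, hb⟩ := ha
  exact le_trans (by positivity) (hb u)

/-- Cauchy-Schwarz inequality for a symmetric bilinear form that is nonnegative on a subspace. -/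
lemma sq_form_le {B : V →ₗ[ℝ] V →ₗ[ℝ] ℝ} (G : Submodule ℝ V) (hs : ∀ u v, B u v = B v u)
    (hB : ∀ u ∈ G, 0 ≤ B u u) {u v : V} (hu : u ∈ G) (hv : v ∈ G) :
    B u v ^ 2 ≤ B u u * B v v := by
  have key : ∀ t : ℝ, 0 ≤ B v v * (t * t) + (2 * B u v) * t + B u u := by
    intro t
    have := hB (u + t • v) (G.add_mem hu (G.smul_mem t hv))
    simp only [map_add, map_smul, LinearMap.add_apply, LinearMap.smul_apply, smul_eq_mul] at this
    rw [hs v u] at this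
    linarith
  have := discrim_le_zero key
  rw [discrim] at this
  linarith

/-- On a closed invariant subspace, a compact operator which is symmetric for a coercive form
and has a positive Rayleigh quotient `≥ m` has an eigenvalue `≥ m`. -/
lemma exists_eigenvector_mem {a : V →L[ℝ] V →L[ℝ] ℝ} (ha : IsCoercive a)
    (hsymm : ∀ u v, a u v = a v u) {T : V →L[ℝ] V} (hT : IsCompactOperator T)
    (hTs : ∀ u v, a (T u) v = a u (T v)) {G : Submodule ℝ V} (hG : IsClosed (G : Set V))
    (hTG : ∀ u ∈ G, T u ∈ G) {m : ℝ} (hm : 0 < m)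
    (hex : ∃ u ∈ G, u ≠ 0 ∧ m * a u u ≤ a (T u) u) :
    ∃ μ, m ≤ μ ∧ ∃ v ∈ G, v ≠ 0 ∧ T v = μ • v := by
  obtain ⟨K, hK, hTK⟩ := exists_abs_form_le ha T
  set S : Set ℝ := {r | ∃ u ∈ G, a u u = 1 ∧ a (T u) u = r} with hS
  have hnormalize : ∀ u ∈ G, u ≠ 0 → a (T u) u / a u u ∈ S := by
    intro u hu hu0
    have hp := form_self_pos ha hu0
    have hsq : (Real.sqrt (a u u))⁻¹ * (Real.sqrt (a u u))⁻¹ = (a u u)⁻¹ := by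
      rw [← mul_inv, Real.mul_self_sqrt hp.le]
    refine ⟨(Real.sqrt (a u u))⁻¹ • u, G.smul_mem _ hu, ?_, ?_⟩
    · simp only [map_smul, _root_.smul_apply, smul_eq_mul]
      rw [← mul_assoc, hsq, inv_mul_cancel₀ hp.ne']
    · simp only [map_smul, _root_.smul_apply, smul_eq_mul]
      rw [← mul_assoc, hsq, div_eq_inv_mul]
  have hbdd : BddAbove S := by
    refine ⟨K, ?_⟩
    rintro r ⟨u, -, h1, rfl⟩
    have := hTK u
    rw [h1, mul_one] at this
    exact (le_abs_self _).trans this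
  obtain ⟨u₀, hu₀, hu₀0, hmu₀⟩ := hex
  have hne : S.Nonempty := ⟨_, hnormalize u₀ hu₀ hu₀0⟩
  set M := sSup S with hM
  have hmM : m ≤ M := le_trans ((le_div_iff₀ (form_self_pos ha hu₀0)).mpr hmu₀)
    (le_csSup hbdd (hnormalize u₀ hu₀ hu₀0))
  have hM0 : 0 < M := hm.trans_le hmM
  have hray : ∀ u ∈ G, a (T u) u ≤ M * a u u := by
    intro u hu
    by_cases hu0 : u = 0
    · simp [hu0]
    · exact (div_le_iff₀ (form_self_pos ha hu0)).mp (le_csSup hbdd (hnormalize u hu hu0))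
  -- `M` is the supremum of the Rayleigh quotient on `G`, so the form `a(Bu, v)` is nonnegative
  -- there; a maximising sequence will be an approximate kernel of `B`.
  set B : V →L[ℝ] V := M • ContinuousLinearMap.id ℝ V - T with hB
  have hBapp : ∀ u, B u = M • u - T u := fun u => rfl
  have haB : ∀ u v, a (B u) v = M * a u v - a (T u) v := by
    intro u v
    rw [hBapp, map_sub, map_smul]
    rfl
  have hBG : ∀ u ∈ G, B u ∈ G := fun u hu => G.sub_mem (G.smul_mem _ hu) (hTG u hu)
  let Q : V →ₗ[ℝ] V →ₗ[ℝ] ℝ := LinearMap.mk₂ ℝ (fun u v => a (B u) v)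
    (fun _ _ _ => by simp) (fun _ _ _ => by simp) (fun _ _ _ => by simp) (fun _ _ _ => by simp)
  have hQapp : ∀ u v, Q u v = a (B u) v := fun u v => rfl
  -- Cauchy-Schwarz for the form `a(B·, ·)` applied to `u` and `Bu`. It upgrades `a(Bu, u) → 0` to
  -- `Bu → 0` in norm, so no weak limits are needed.
  have hBK : ∀ u ∈ G, a (B u) (B u) ≤ (M + K) * a (B u) u := by
    intro u hu
    have cs := sq_form_le (B := Q) G
      (fun u v => by rw [hQapp, hQapp, haB, haB, hTs, hsymm u v, hsymm u (T v)])
      (fun u hu => by rw [hQapp, haB]; linarith [hray u hu]) hu (hBG u hu)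
    simp only [hQapp] at cs
    have h1 : a (B (B u)) (B u) ≤ (M + K) * a (B u) (B u) := by
      rw [haB]
      linarith [hTK (B u), neg_abs_le (a (T (B u)) (B u))]
    have h2 : 0 ≤ a (B u) u := by rw [haB]; linarith [hray u hu]
    rcases (form_self_nonneg ha (B u)).eq_or_lt with h0 | h0
    · rw [← h0]; positivity
    · have h3 := cs.trans (mul_le_mul_of_nonneg_left h1 h2)
      have : a (B u) (B u) * a (B u) (B u) ≤ ((M + K) * a (B u) u) * a (B u) (B u) := by
        linarith
      exact le_of_mul_le_mul_right this h0
  obtain ⟨r, -, hrt, hrS⟩ := exists_seq_tendsto_sSup hne hbdd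
  choose u huG hu1 hur using hrS
  obtain ⟨C, hC, hb⟩ := ha
  have hBu : Tendsto (fun n => B (u n)) atTop (𝓝 0) := by
    have h1 : Tendsto (fun n => (M + K) * (M - r n) / C) atTop (𝓝 0) := by
      have : Tendsto (fun n => (M + K) * (M - r n) / C) atTop (𝓝 ((M + K) * (M - M) / C)) :=
        ((tendsto_const_nhds.sub hrt).const_mul _).div_const _
      simpa using this
    have h2 : Tendsto (fun n => ‖B (u n)‖ ^ 2) atTop (𝓝 0) := by
      refine squeeze_zero (fun n => by positivity) (fun n => ?_) h1
      rw [le_div_iff₀ hC]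
      have e1 := hb (B (u n))
      have e2 := hBK (u n) (huG n)
      have e3 : a (B (u n)) (u n) = M - r n := by rw [haB, hu1, hur, mul_one]
      rw [e3] at e2
      nlinarith
    rw [tendsto_zero_iff_norm_tendsto_zero]
    have h3 := (Real.continuous_sqrt.tendsto 0).comp h2
    simpa [Function.comp_def] using h3
  have hub : ∀ n, u n ∈ Metric.closedBall (0 : V) (Real.sqrt (1 / C)) := by
    intro n
    rw [mem_closedBall_zero_iff]
    refine Real.le_sqrt_of_sq_le ?_
    rw [le_div_iff₀ hC]
    have := hb (u n)
    rw [hu1] at this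
    nlinarith
  obtain ⟨Z, hZ, hZT⟩ := hT.image_closedBall_subset_compact (f := (T : V →ₗ[ℝ] V))
    (Real.sqrt (1 / C))
  obtain ⟨w, -, φ, hφ, hw⟩ := hZ.tendsto_subseq (fun n => hZT ⟨u n, hub n, rfl⟩)
  have hw' : Tendsto (fun n => T (u (φ n))) atTop (𝓝 w) := hw
  -- `M u = Bu + Tu`: the first term tends to zero and the second converges along the subsequence,
  -- so the maximising vectors themselves converge strongly, which uses `M > 0`.
  have huφ : Tendsto (fun n => u (φ n)) atTop (𝓝 (M⁻¹ • w)) := by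
    have h1 := ((hBu.comp hφ.tendsto_atTop).add hw').const_smul M⁻¹
    rw [zero_add] at h1
    refine h1.congr fun n => ?_
    simp only [Function.comp_apply, hBapp, sub_add_cancel]
    rw [smul_smul, inv_mul_cancel₀ hM0.ne', one_smul]
  have hTv : T (M⁻¹ • w) = M • (M⁻¹ • w) := by
    rw [smul_smul, mul_inv_cancel₀ hM0.ne', one_smul]
    exact tendsto_nhds_unique ((T.continuous.tendsto _).comp huφ) hw'
  refine ⟨M, hmM, M⁻¹ • w, hG.mem_of_tendsto huφ (Eventually.of_forall fun n => huG _), ?_, hTv⟩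
  -- The normalisation `a(u, u) = 1` passes to the strong limit, so the limit cannot vanish.
  intro h0
  have hc : Continuous fun x : V => a x x := a.continuous.clm_apply continuous_id
  have h1 := (hc.tendsto _).comp huφ
  rw [h0] at h1
  have h2 : Tendsto (fun _ : ℕ => (1 : ℝ)) atTop (𝓝 (a (0 : V) 0)) :=
    h1.congr fun n => hu1 _
  have := tendsto_nhds_unique h2 tendsto_const_nhds
  simp at this

/-- Lower bound for the number of eigenvalues `≥ m`, counted with multiplicity. -/
lemma le_rank_iSup_eigenspace {a : V →L[ℝ] V →L[ℝ] ℝ} (ha : IsCoercive a)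
    (hsymm : ∀ u v, a u v = a v u) {T : V →L[ℝ] V} (hT : IsCompactOperator T)
    (hTs : ∀ u v, a (T u) v = a u (T v)) {m : ℝ} (hm : 0 < m) {k : ℕ}
    (L : (Fin (k + 1) → ℝ) →ₗ[ℝ] V) (hL : Function.Injective L)
    (hLm : ∀ c, m * a (L c) (L c) ≤ a (T (L c)) (L c)) :
    ((k + 1 : ℕ) : Cardinal) ≤
      Module.rank ℝ ↥(⨆ ν ∈ Set.Ici m, Module.End.eigenspace (T : Module.End ℝ V) ν) := by
  -- If the eigenspaces for values `≥ m` span only a space `F` of dimension at most `k`, the image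
  -- of `L` meets the `a`-orthogonal complement of `F`. That complement is closed and `T`-invariant,
  -- so it contains an eigenvector with eigenvalue `≥ m`; this vector also lies in `F` and is
  -- orthogonal to itself.
  by_contra hlt
  rw [not_le] at hlt
  set F := ⨆ ν ∈ Set.Ici m, Module.End.eigenspace (T : Module.End ℝ V) ν with hF
  have hfin : Module.Finite ℝ F :=
    Module.rank_lt_aleph0_iff.mp (hlt.trans (Cardinal.natCast_lt_aleph0))
  have hfr : Module.finrank ℝ F < k + 1 := by
    rw [← Module.finrank_eq_rank] at hlt
    exact_mod_cast hlt
  have hTF : ∀ f ∈ F, T f ∈ F := by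
    intro f hf
    have : F ≤ F.comap (T : V →ₗ[ℝ] V) := by
      conv_lhs => rw [hF]
      refine iSup₂_le fun ν hν x hx => ?_
      have hx' : T x = ν • x := Module.End.mem_eigenspace_iff.mp hx
      have hxF : x ∈ F := (le_iSup₂ (f := fun ν (_ : ν ∈ Set.Ici m) =>
        Module.End.eigenspace (T : Module.End ℝ V) ν) ν hν) hx
      rw [Submodule.mem_comap]
      change T x ∈ F
      rw [hx']
      exact F.smul_mem _ hxF
    exact this hf
  let R : V →ₗ[ℝ] Module.Dual ℝ F :=
    { toFun := fun u => ((a u : V →L[ℝ] ℝ) : V →ₗ[ℝ] ℝ).domRestrict F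
      map_add' := fun u v => by ext; simp
      map_smul' := fun c u => by ext; simp }
  have hR : ∀ u (f : F), R u f = a u f := fun u f => rfl
  have hker : LinearMap.ker (R ∘ₗ L) ≠ ⊥ := by
    refine LinearMap.ker_ne_bot_of_finrank_lt ?_
    rw [Subspace.dual_finrank_eq]
    simpa using hfr
  obtain ⟨c, hc, hc0⟩ := Submodule.exists_mem_ne_zero_of_ne_bot hker
  have hGmem : ∀ u, u ∈ LinearMap.ker R ↔ ∀ f ∈ F, a u f = 0 := by
    intro u
    rw [LinearMap.mem_ker]
    refine ⟨fun h f hf => ?_, fun h => ?_⟩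
    · rw [← hR u ⟨f, hf⟩, h]; rfl
    · ext f; exact h f f.2
  have hclosed : IsClosed (LinearMap.ker R : Set V) := by
    have : (LinearMap.ker R : Set V) = ⋂ f ∈ F, {u | a u f = 0} := by
      ext u; simp only [SetLike.mem_coe, hGmem, Set.mem_iInter]; rfl
    rw [this]
    exact isClosed_biInter fun f _ =>
      isClosed_eq (a.continuous.clm_apply continuous_const) continuous_const
  obtain ⟨μ, hμ, v, hv, hv0, hTv⟩ := exists_eigenvector_mem ha hsymm hT hTs hclosed
    (fun u hu => by
      rw [hGmem] at hu ⊢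
      exact fun f hf => by rw [hTs]; exact hu _ (hTF f hf)) hm
    ⟨L c, hc, fun h => hc0 (hL (by rw [h, map_zero])), hLm c⟩
  have hvF : v ∈ F := (le_iSup₂ (f := fun ν (_ : ν ∈ Set.Ici m) =>
    Module.End.eigenspace (T : Module.End ℝ V) ν) μ hμ) (Module.End.mem_eigenspace_iff.mpr hTv)
  exact (form_self_pos ha hv0).ne' ((hGmem v).mp hv v hvF)

/-- Two-sided bound for the `k`-th eigenvalue in terms of Rayleigh quotients. -/
lemma kthEigenvalue_mem_Icc {a : V →L[ℝ] V →L[ℝ] ℝ} (ha : IsCoercive a)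
    (hsymm : ∀ u v, a u v = a v u) {T : V →L[ℝ] V} (hT : IsCompactOperator T)
    (hTs : ∀ u v, a (T u) v = a u (T v)) {m M : ℝ} (hm : 0 < m) {k : ℕ}
    (L : (Fin (k + 1) → ℝ) →ₗ[ℝ] V) (hL : Function.Injective L)
    (hLm : ∀ c, m * a (L c) (L c) ≤ a (T (L c)) (L c)) (hM : ∀ u, a (T u) u ≤ M * a u u) :
    kthEigenvalue (T : Module.End ℝ V) k ∈ Set.Icc m M := by
  have hmem := le_rank_iSup_eigenspace ha hsymm hT hTs hm L hL hLm
  have hub : ∀ μ ∈ {μ : ℝ | ((k + 1 : ℕ) : Cardinal) ≤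
      Module.rank ℝ ↥(⨆ ν ∈ Set.Ici μ, Module.End.eigenspace (T : Module.End ℝ V) ν)},
      μ ≤ M := by
    intro μ hμ
    by_contra! hlt
    have hbot : ⨆ ν ∈ Set.Ici μ, Module.End.eigenspace (T : Module.End ℝ V) ν = ⊥ := by
      refine le_bot_iff.mp (iSup₂_le fun ν hν x hx => ?_)
      rw [Submodule.mem_bot]
      by_contra hx0
      have hx' : T x = ν • x := Module.End.mem_eigenspace_iff.mp hx
      have h1 := hM x
      rw [hx', map_smul] at h1
      have h2 : ν ≤ M := le_of_mul_le_mul_right h1 (form_self_pos ha hx0)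
      exact absurd (hlt.trans_le hν) (not_lt.mpr h2)
    have hμ' := Set.mem_ofPred_eq ▸ hμ
    rw [hbot, rank_bot] at hμ'
    have : (k + 1 : ℕ) ≤ 0 := by exact_mod_cast hμ'
    omega
  -- The set defining the eigenvalue contains `m` and is bounded by `M`, so its `sSup` is a true
  -- supremum rather than a default value.
  exact ⟨le_csSup ⟨M, hub⟩ hmem, csSup_le ⟨m, hmem⟩ hub⟩

end Spectral

/-! ### Translation estimate in `H¹` -/

section Translation

lemma norm_toLp_smul_const {n : ℕ} {φ : Eucl n → ℝ} (h : ContDiff ℝ ∞ φ) (hc : HasCompactSupport φ)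
    (v : Eucl n) : ‖(memLp_smul_const h hc v).toLp _‖ =
      ‖v‖ * ‖(h.continuous.memLp_of_hasCompactSupport hc (p := 2) (μ := volume)).toLp φ‖ := by
  rw [Lp.norm_toLp, Lp.norm_toLp]
  have : eLpNorm (fun x => φ x • v) 2 (volume : Measure (Eucl n)) =
      eLpNorm (‖v‖ • φ) 2 volume := by
    refine eLpNorm_congr_norm_ae (Eventually.of_forall fun x => ?_)
    simp [norm_smul, mul_comm]
  rw [this, eLpNorm_const_smul, ENNReal.toReal_mul]
  simp

lemma contDiff_comp_sub {n : ℕ} {φ : Eucl n → ℝ} (h : ContDiff ℝ ∞ φ) (y : Eucl n) :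
    ContDiff ℝ ∞ fun x => φ (x - y) := h.comp (contDiff_id.sub contDiff_const)

lemma hasCompactSupport_comp_sub {n : ℕ} {φ : Eucl n → ℝ} (hc : HasCompactSupport φ)
    (y : Eucl n) : HasCompactSupport fun x => φ (x - y) :=
  hc.comp_homeomorph (Homeomorph.subRight y)

/-- The correlation `y ↦ ∫ u(x) φ(x - y)` of `u ∈ H¹` with a test function has the expected
derivative. -/
lemma hasDerivAt_integral_mul_comp_sub {n : ℕ} (u : H1 n) {φ : Eucl n → ℝ} (h : ContDiff ℝ ∞ φ)
    (hc : HasCompactSupport φ) (v : Eucl n) (t : ℝ) :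
    HasDerivAt (fun t : ℝ => ∫ x, toL2 n u x * φ (x - t • v))
      (∫ x, ⟪grad n u x, v⟫ * φ (x - t • v)) t := by
  -- Reflecting `φ` turns the correlation into a convolution, whose derivative falls on the smooth
  -- factor; the weak gradient then moves it onto `u`.
  set ψ : Eucl n → ℝ := fun y => φ (-y) with hψ
  have hψd : ContDiff ℝ ∞ ψ := h.comp contDiff_neg
  have hψc : HasCompactSupport ψ := hc.comp_homeomorph (Homeomorph.neg _)
  have hloc : LocallyIntegrable (toL2 n u : Eucl n → ℝ) volume :=
    (Lp.memLp (toL2 n u)).locallyIntegrable one_le_two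
  have key := hψc.hasFDerivAt_convolution_right (ContinuousLinearMap.mul ℝ ℝ) hloc
    (hψd.of_le (by simp)) (t • v)
  have hline : HasDerivAt (fun t : ℝ => t • v) v t := by
    simpa using (hasDerivAt_id t).smul_const v
  have hder := key.comp_hasDerivAt t hline
  have e0 : (convolution (toL2 n u) ψ (ContinuousLinearMap.mul ℝ ℝ) volume) ∘ (fun t : ℝ => t • v)
      = fun t : ℝ => ∫ x, toL2 n u x * φ (x - t • v) := by
    ext t
    simp [convolution, hψ]
  rw [e0] at hder
  refine hder.congr_deriv ?_
  rw [convolution_precompR_apply _ hloc (hψc.fderiv ℝ) (hψd.continuous_fderiv (by simp))]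
  have hw := isWeakGradient_grad u _ (contDiff_comp_sub h (t • v))
    (hasCompactSupport_comp_sub hc (t • v)) v
  rw [← neg_eq_iff_eq_neg, ← integral_neg] at hw
  rw [← hw]
  refine integral_congr_ae (Eventually.of_forall fun x => ?_)
  have h1 : fderiv ℝ (fun x => φ (x - t • v)) x = fderiv ℝ φ (x - t • v) := fderiv_comp_sub _
  have h2 : fderiv ℝ ψ (t • v - x) = - fderiv ℝ φ (x - t • v) := by
    have hφ : HasFDerivAt φ (fderiv ℝ φ (x - t • v)) (-(t • v - x)) := by
      rw [neg_sub]
      exact (h.differentiable (by simp) _).hasFDerivAt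
    have := (hφ.comp (t • v - x) (hasFDerivAt_id (𝕜 := ℝ) (t • v - x)).neg).fderiv
    refine this.trans ?_
    ext y
    simp
  simp [h1, h2]

/-- The translate `u(· + h)` of an `L²` function. -/
def translate {n : ℕ} (h : Eucl n) (f : L2 n) : L2 n :=
  Lp.compMeasurePreserving (· + h) (measurePreserving_add_right volume h) f

lemma coeFn_translate {n : ℕ} (h : Eucl n) (f : L2 n) :
    translate h f =ᵐ[volume] fun x => f (x + h) :=
  Lp.coeFn_compMeasurePreserving _ _

/-- Mean value inequality on `[0, 1]` for `t ↦ ∫ u(x) φ(x - tv)`: its derivative is bounded by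
Cauchy-Schwarz, uniformly in `t` because translation preserves the `L²` norm of `φ`. -/
lemma abs_inner_translate_sub_le {n : ℕ} (u : H1 n) (v : Eucl n) {φ : Eucl n → ℝ}
    (h : ContDiff ℝ ∞ φ) (hc : HasCompactSupport φ) :
    |⟪translate v (toL2 n u) - toL2 n u,
      (h.continuous.memLp_of_hasCompactSupport hc (p := 2) (μ := volume)).toLp φ⟫| ≤
      ‖v‖ * ‖grad n u‖ *
        ‖(h.continuous.memLp_of_hasCompactSupport hc (p := 2) (μ := volume)).toLp φ‖ := by
  set Φ := (h.continuous.memLp_of_hasCompactSupport hc (p := 2) (μ := volume)).toLp φ with hΦ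
  have hΦc : Φ =ᵐ[volume] φ := MemLp.coeFn_toLp _
  have e1 : ⟪translate v (toL2 n u), Φ⟫ = ∫ x, toL2 n u x * φ (x - (1 : ℝ) • v) := by
    rw [L2.inner_def, ← integral_add_right_eq_self (fun x => toL2 n u x * φ (x - (1 : ℝ) • v)) v]
    refine integral_congr_ae ?_
    filter_upwards [coeFn_translate v (toL2 n u), hΦc] with x h1 h2
    simp [h1, h2, mul_comm]
  have e0 : ⟪toL2 n u, Φ⟫ = ∫ x, toL2 n u x * φ (x - (0 : ℝ) • v) := by
    rw [L2.inner_def]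
    refine integral_congr_ae ?_
    filter_upwards [hΦc] with x h2
    simp [h2, mul_comm]
  have hbound : ∀ t ∈ Set.Ico (0 : ℝ) 1,
      ‖∫ x, ⟪grad n u x, v⟫ * φ (x - t • v)‖ ≤ ‖v‖ * ‖grad n u‖ * ‖Φ‖ := by
    intro t _
    have hd := contDiff_comp_sub h (t • v)
    have hs := hasCompactSupport_comp_sub hc (t • v)
    rw [← inner_smul_const hd hs v (grad n u)]
    refine (norm_inner_le_norm _ _).trans ?_
    rw [norm_toLp_smul_const hd hs v]
    have : ‖(hd.continuous.memLp_of_hasCompactSupport hs (p := 2) (μ := volume)).toLp _‖ = ‖Φ‖ := by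
      rw [hΦ, Lp.norm_toLp, Lp.norm_toLp]
      congr 1
      exact eLpNorm_comp_measurePreserving (g := φ) h.continuous.aestronglyMeasurable
        (measurePreserving_sub_right volume (t • v))
    rw [this]
    exact le_of_eq (by ring)
  have := norm_image_sub_le_of_norm_deriv_le_segment_01'
    (fun t _ => (hasDerivAt_integral_mul_comp_sub u h hc v t).hasDerivWithinAt) hbound
  rw [inner_sub_left, e1, e0]
  exact this

/-- Translation estimate for `H¹` functions. -/
lemma norm_translate_sub_le {n : ℕ} (u : H1 n) (v : Eucl n) :
    ‖translate v (toL2 n u) - toL2 n u‖ ≤ ‖v‖ * ‖grad n u‖ := by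
  set d := translate v (toL2 n u) - toL2 n u with hd
  -- The bound is a closed condition on `f`, so it extends from test functions by density; taking `f
  -- = d` then gives the norm of `d`.
  have hall : ∀ f : L2 n, |⟪d, f⟫| ≤ ‖v‖ * ‖grad n u‖ * ‖f‖ := by
    intro f
    have hcl : IsClosed {f : L2 n | |⟪d, f⟫| ≤ ‖v‖ * ‖grad n u‖ * ‖f‖} :=
      isClosed_le (continuous_const.inner continuous_id).abs
        (continuous_const.mul continuous_norm)
    refine hcl.closure_subset_iff.mpr ?_
      (Lp.dense_hasCompactSupport_contDiff (F := ℝ) (E := Eucl n) (p := 2) (μ := volume)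
        (by simp) f)
    rintro f ⟨g, hfg, hgc, hgd⟩
    have := abs_inner_translate_sub_le u v hgd hgc
    have hfe : f = (hgd.continuous.memLp_of_hasCompactSupport hgc (p := 2) (μ := volume)).toLp g :=
      Lp.ext (hfg.trans (MemLp.coeFn_toLp _).symm)
    rw [← hfe] at this
    exact this
  have h1 := hall d
  rw [real_inner_self_eq_norm_sq, abs_of_nonneg (by positivity), pow_two] at h1
  rcases (norm_nonneg d).eq_or_lt with h0 | h0
  · rw [← h0]; positivity
  · exact le_of_mul_le_mul_right h1 h0

end Translation

/-! ### Local Rellich theorem and compactness of multiplication -/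

section Rellich

lemma enorm_sq_eq_lintegral {α F : Type*} [MeasurableSpace α] [NormedAddCommGroup F]
    {μ : Measure α} (f : Lp F 2 μ) : ‖f‖ₑ ^ 2 = ∫⁻ x, ‖f x‖ₑ ^ 2 ∂μ := by
  have := eLpNorm_nnreal_pow_eq_lintegral (μ := μ) (f := f) (p := 2) (by norm_num)
  rw [Lp.enorm_def]
  simpa using this

lemma sq_lintegral_le {α : Type*} [MeasurableSpace α] (μ : Measure α) {g : α → ℝ≥0∞}
    (hg : AEMeasurable g μ) : (∫⁻ x, g x ∂μ) ^ 2 ≤ μ Set.univ * ∫⁻ x, g x ^ 2 ∂μ := by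
  have := ENNReal.lintegral_mul_le_Lp_mul_Lq μ Real.HolderConjugate.two_two
    (f := fun _ => 1) aemeasurable_const hg
  simp only [Pi.mul_apply, one_mul, ENNReal.one_rpow, lintegral_const] at this
  refine (pow_le_pow_left₀ (zero_le) this 2).trans (le_of_eq ?_)
  rw [mul_pow, ← ENNReal.rpow_natCast, ← ENNReal.rpow_natCast, ← ENNReal.rpow_mul,
    ← ENNReal.rpow_mul]
  simp

/-- Jensen's inequality for the square of the distance to a mean value. -/
lemma enorm_sub_average_sq_le {α : Type*} [MeasurableSpace α] (μ : Measure α)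
    {s : Set α} (h0 : μ s ≠ 0) (htop : μ s ≠ ⊤) {f : α → ℝ} (hf : IntegrableOn f s μ) (r : ℝ) :
    ‖r - (μ.real s)⁻¹ * ∫ y in s, f y ∂μ‖ₑ ^ 2 ≤ (μ s)⁻¹ * ∫⁻ y in s, ‖r - f y‖ₑ ^ 2 ∂μ := by
  have hpos : μ.real s ≠ 0 := ENNReal.toReal_ne_zero.mpr ⟨h0, htop⟩
  have e : r - (μ.real s)⁻¹ * ∫ y in s, f y ∂μ = (μ.real s)⁻¹ * ∫ y in s, (r - f y) ∂μ := by
    rw [integral_sub (integrableOn_const (C := r) htop) hf, setIntegral_const, mul_sub, smul_eq_mul,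
      inv_mul_cancel_left₀ hpos]
  have hinv : ‖(μ.real s)⁻¹‖ₑ = (μ s)⁻¹ := by
    rw [enorm_inv hpos, Real.enorm_of_nonneg measureReal_nonneg, ofReal_measureReal htop]
  rw [e, enorm_mul, hinv, mul_pow]
  have h1 : ‖∫ y in s, (r - f y) ∂μ‖ₑ ^ 2 ≤ μ s * ∫⁻ y in s, ‖r - f y‖ₑ ^ 2 ∂μ := by
    refine (pow_le_pow_left₀ (zero_le) (enorm_integral_le_lintegral_enorm _) 2).trans ?_
    have := sq_lintegral_le (μ.restrict s) (g := fun y => ‖r - f y‖ₑ)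
      (aestronglyMeasurable_const.sub hf.aestronglyMeasurable).enorm
    rwa [Measure.restrict_apply_univ] at this
  calc (μ s)⁻¹ ^ 2 * ‖∫ y in s, (r - f y) ∂μ‖ₑ ^ 2
      ≤ (μ s)⁻¹ ^ 2 * (μ s * ∫⁻ y in s, ‖r - f y‖ₑ ^ 2 ∂μ) := by gcongr
    _ = (μ s)⁻¹ * ((μ s)⁻¹ * μ s) * ∫⁻ y in s, ‖r - f y‖ₑ ^ 2 ∂μ := by ring
    _ = _ := by rw [ENNReal.inv_mul_cancel h0 htop, mul_one]

/-- The mean square oscillation of an `H¹` function at scale `ε`. -/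
lemma lintegral_ball_oscillation_le {n : ℕ} (u : H1 n) {ε : ℝ} :
    ∫⁻ x, ∫⁻ h in Metric.ball (0 : Eucl n) ε, ‖toL2 n u x - toL2 n u (x + h)‖ₑ ^ 2 ≤
      volume (Metric.ball (0 : Eucl n) ε) * ENNReal.ofReal ((ε * ‖grad n u‖) ^ 2) := by
  have hm : StronglyMeasurable (toL2 n u : Eucl n → ℝ) := Lp.stronglyMeasurable _
  have hmeas : Measurable fun p : Eucl n × Eucl n =>
      ‖toL2 n u p.1 - toL2 n u (p.1 + p.2)‖ₑ ^ 2 := by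
    have := hm.measurable
    fun_prop
  rw [lintegral_lintegral_swap hmeas.aemeasurable]
  calc ∫⁻ h in Metric.ball (0 : Eucl n) ε, ∫⁻ x, ‖toL2 n u x - toL2 n u (x + h)‖ₑ ^ 2
      ≤ ∫⁻ h in Metric.ball (0 : Eucl n) ε, ENNReal.ofReal ((ε * ‖grad n u‖) ^ 2) := by
        refine setLIntegral_mono measurable_const fun h hh => ?_
        have e : ∫⁻ x, ‖toL2 n u x - toL2 n u (x + h)‖ₑ ^ 2 =
            ‖translate h (toL2 n u) - toL2 n u‖ₑ ^ 2 := by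
          rw [enorm_sq_eq_lintegral]
          refine lintegral_congr_ae ?_
          filter_upwards [Lp.coeFn_sub (translate h (toL2 n u)) (toL2 n u),
            coeFn_translate h (toL2 n u)] with x h1 h2
          rw [h1, Pi.sub_apply, h2, ← enorm_neg, neg_sub]
        rw [e, ← ofReal_norm, ← ENNReal.ofReal_pow (norm_nonneg _)]
        refine ENNReal.ofReal_le_ofReal (pow_le_pow_left₀ (norm_nonneg _) ?_ 2)
        refine (norm_translate_sub_le u h).trans ?_
        gcongr
        exact (mem_ball_zero_iff.mp hh).le
    _ = _ := by rw [setLIntegral_const, mul_comm]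

/-- By total boundedness of the ball, finitely many centres suffice. Sending each point to a nearest
one is a measurable choice with finite range, which makes the averaging operator of finite rank. -/
lemma exists_simpleFunc_dist_lt {n : ℕ} (R : ℝ) {δ : ℝ} (hδ : 0 < δ) :
    ∃ c : SimpleFunc (Eucl n) (Eucl n), ∀ x ∈ Metric.ball (0 : Eucl n) R, dist (c x) x < δ := by
  set e := TopologicalSpace.denseSeq (Eucl n) with he
  obtain ⟨t, ht⟩ := (isCompact_closedBall (0 : Eucl n) R).elim_finite_subcover
    (fun i => Metric.ball (e i) δ) (fun i => Metric.isOpen_ball) (fun x _ => by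
      obtain ⟨i, hi⟩ := (TopologicalSpace.denseRange_denseSeq (Eucl n)).exists_dist_lt x hδ
      exact Set.mem_iUnion.mpr ⟨i, hi⟩)
  refine ⟨SimpleFunc.nearestPt e (t.sup id), fun x hx => ?_⟩
  have hx' := ht (Metric.ball_subset_closedBall hx)
  simp only [Set.mem_iUnion] at hx'
  obtain ⟨i, hi, hxi⟩ := hx'
  have h1 := SimpleFunc.edist_nearestPt_le e x (Finset.le_sup (f := id) hi)
  rw [edist_dist, edist_dist, id, ENNReal.ofReal_le_ofReal_iff dist_nonneg] at h1
  rw [Metric.mem_ball, dist_comm] at hxi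
  exact h1.trans_lt hxi

lemma memLp_indicator_ball (n : ℕ) (R : ℝ) :
    MemLp ((Metric.ball (0 : Eucl n) R).indicator fun _ => (1 : ℝ)) ∞ volume :=
  memLp_indicator_const ∞ Metric.isOpen_ball.measurableSet 1 (Or.inr measure_ball_lt_top.ne)

/-- The restriction of an `L²` function to a ball. -/
def cutoff (n : ℕ) (R : ℝ) : L2 n →L[ℝ] L2 n := mulPotential _ (memLp_indicator_ball n R)

lemma measurableSet_cell {n : ℕ} (R : ℝ) (c : SimpleFunc (Eucl n) (Eucl n)) (y : Eucl n) :
    MeasurableSet (Metric.ball (0 : Eucl n) R ∩ c ⁻¹' {y}) :=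
  Metric.isOpen_ball.measurableSet.inter (c.measurableSet_fiber y)

lemma measure_cell_ne_top {n : ℕ} (R : ℝ) (c : SimpleFunc (Eucl n) (Eucl n)) (y : Eucl n) :
    volume (Metric.ball (0 : Eucl n) R ∩ c ⁻¹' {y}) ≠ ⊤ :=
  ((measure_mono Set.inter_subset_left).trans_lt measure_ball_lt_top).ne

/-- The finite rank operator `u ↦ 1_{|x| < R} ⨍_{B(c(x), δ)} u`. -/
def ballAverage (n : ℕ) (R δ : ℝ) (c : SimpleFunc (Eucl n) (Eucl n)) : L2 n →L[ℝ] L2 n :=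
  ∑ y ∈ c.range, (ContinuousLinearMap.toSpanSingleton ℝ
    (indicatorConstLp 2 (measurableSet_cell R c y) (measure_cell_ne_top R c y) (1 : ℝ))).comp
    ((volume.real (Metric.ball y δ))⁻¹ • innerSL ℝ (indicatorConstLp 2
      (Metric.isOpen_ball.measurableSet : MeasurableSet (Metric.ball y δ))
      measure_ball_lt_top.ne (1 : ℝ)))

lemma isCompactOperator_ballAverage (n : ℕ) (R δ : ℝ) (c : SimpleFunc (Eucl n) (Eucl n)) :
    IsCompactOperator (ballAverage n R δ c) := by
  have : ballAverage n R δ c ∈ compactOperator (RingHom.id ℝ) (L2 n) (L2 n) := by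
    refine Submodule.sum_mem _ fun y _ => ?_
    have h : IsCompactOperator (ContinuousLinearMap.toSpanSingleton ℝ (indicatorConstLp 2
        (measurableSet_cell R c y) (measure_cell_ne_top R c y) (1 : ℝ))) :=
      isCompactOperator_of_locallyCompactSpace_rng _
    exact h.comp_clm _
  exact this

lemma ballAverage_ae {n : ℕ} (R δ : ℝ) (c : SimpleFunc (Eucl n) (Eucl n)) (f : L2 n) :
    ballAverage n R δ c f =ᵐ[volume] (Metric.ball (0 : Eucl n) R).indicator fun x =>
      (volume.real (Metric.ball (c x) δ))⁻¹ * ∫ y in Metric.ball (c x) δ, f y := by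
  have e : ballAverage n R δ c f = ∑ y ∈ c.range,
      ((volume.real (Metric.ball y δ))⁻¹ * ∫ z in Metric.ball y δ, f z) •
      indicatorConstLp 2 (measurableSet_cell R c y) (measure_cell_ne_top R c y) (1 : ℝ) := by
    rw [ballAverage, _root_.sum_apply]
    refine Finset.sum_congr rfl fun y _ => ?_
    simp only [ContinuousLinearMap.comp_apply, ContinuousLinearMap.toSpanSingleton_apply,
      _root_.smul_apply, innerSL_apply_apply, smul_eq_mul]
    rw [L2.inner_indicatorConstLp_one]
  rw [e]
  refine (Lp.coeFn_finsetSum _ _).trans ?_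
  have hall : ∀ᵐ x ∂(volume : Measure (Eucl n)), ∀ y ∈ c.range,
      (((volume.real (Metric.ball y δ))⁻¹ * ∫ z in Metric.ball y δ, f z) •
        indicatorConstLp 2 (measurableSet_cell R c y) (measure_cell_ne_top R c y) (1 : ℝ)
          : L2 n) x = ((volume.real (Metric.ball y δ))⁻¹ * ∫ z in Metric.ball y δ, f z) *
        (Metric.ball (0 : Eucl n) R ∩ c ⁻¹' {y}).indicator (fun _ => (1 : ℝ)) x := by
    refine (Finset.eventually_all c.range).mpr fun y _ => ?_
    filter_upwards [Lp.coeFn_smul ((volume.real (Metric.ball y δ))⁻¹ * ∫ z in Metric.ball y δ, f z)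
        (indicatorConstLp 2 (measurableSet_cell R c y) (measure_cell_ne_top R c y) (1 : ℝ)),
      indicatorConstLp_coeFn (p := 2) (hs := measurableSet_cell R c y)
        (hμs := measure_cell_ne_top R c y) (c := (1 : ℝ))] with x h1 h2
    rw [h1, Pi.smul_apply, h2, smul_eq_mul]
  filter_upwards [hall] with x hx
  rw [Finset.sum_apply, Finset.sum_congr rfl fun y hy => hx y hy]
  by_cases hxR : x ∈ Metric.ball (0 : Eucl n) R
  · rw [Set.indicator_of_mem hxR, Finset.sum_eq_single (c x)]
    · have hmem : x ∈ Metric.ball (0 : Eucl n) R ∩ c ⁻¹' {c x} := ⟨hxR, rfl⟩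
      rw [Set.indicator_of_mem hmem, mul_one]
    · intro y _ hy
      rw [Set.indicator_of_notMem (fun h => hy h.2.symm), mul_zero]
    · exact fun h => absurd (c.mem_range_self x) h
  · rw [Set.indicator_of_notMem hxR]
    exact Finset.sum_eq_zero fun y _ => by
      rw [Set.indicator_of_notMem (fun h => hxR h.1), mul_zero]

/-- Since `B(c(x), δ) ⊆ B(x, 2δ)`, Jensen bounds the pointwise error by the oscillation of `u` at
scale `2δ` about `x`. Integrating in `x` brings in the translation estimate; the factor `2 ^ n` is
the volume ratio of balls of radii `2δ` and `δ`. -/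
lemma norm_cutoff_sub_ballAverage_le {n : ℕ} {R δ : ℝ} (hδ : 0 < δ)
    {c : SimpleFunc (Eucl n) (Eucl n)} (hc : ∀ x ∈ Metric.ball (0 : Eucl n) R, dist (c x) x < δ)
    (u : H1 n) : ‖cutoff n R (toL2 n u) - ballAverage n R δ c (toL2 n u)‖ ^ 2 ≤
      2 ^ n * (2 * δ * ‖grad n u‖) ^ 2 := by
  set f := toL2 n u with hf
  set v := volume (Metric.ball (0 : Eucl n) δ) with hv
  have hv0 : v ≠ 0 := (Metric.measure_ball_pos volume _ hδ).ne'
  have hvt : v ≠ ⊤ := measure_ball_lt_top.ne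
  have hball : ∀ y : Eucl n, volume (Metric.ball y δ) = v := fun y =>
    Measure.addHaar_ball_center volume y δ
  have hloc : LocallyIntegrable (f : Eucl n → ℝ) volume :=
    (Lp.memLp f).locallyIntegrable one_le_two
  have hpt : ∀ x ∈ Metric.ball (0 : Eucl n) R,
      ‖f x - (volume.real (Metric.ball (c x) δ))⁻¹ * ∫ y in Metric.ball (c x) δ, f y‖ₑ ^ 2 ≤
      v⁻¹ * ∫⁻ h in Metric.ball (0 : Eucl n) (2 * δ), ‖f x - f (x + h)‖ₑ ^ 2 := by
    intro x hx
    have hint : IntegrableOn (f : Eucl n → ℝ) (Metric.ball (c x) δ) volume :=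
      (hloc.integrableOn_isCompact (isCompact_closedBall (c x) δ)).mono_set
        Metric.ball_subset_closedBall
    have h1 := enorm_sub_average_sq_le volume (s := Metric.ball (c x) δ)
      (by rw [hball]; exact hv0) (by rw [hball]; exact hvt) hint (f x)
    rw [hball] at h1
    refine h1.trans ?_
    gcongr 1
    have h2 : ∫⁻ y in Metric.ball (c x) δ, ‖f x - f y‖ₑ ^ 2 ≤
        ∫⁻ y in Metric.ball x (2 * δ), ‖f x - f y‖ₑ ^ 2 := by
      refine lintegral_mono_set (Metric.ball_subset_ball' ?_)
      linarith [hc x hx]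
    refine h2.trans (le_of_eq ?_)
    rw [← lintegral_indicator Metric.isOpen_ball.measurableSet,
      ← lintegral_indicator Metric.isOpen_ball.measurableSet,
      ← lintegral_add_left_eq_self _ x]
    refine lintegral_congr fun h => ?_
    have hiff : x + h ∈ Metric.ball x (2 * δ) ↔ h ∈ Metric.ball (0 : Eucl n) (2 * δ) := by simp
    by_cases hh : h ∈ Metric.ball (0 : Eucl n) (2 * δ)
    · rw [Set.indicator_of_mem hh, Set.indicator_of_mem (hiff.mpr hh)]
    · rw [Set.indicator_of_notMem hh, Set.indicator_of_notMem (mt hiff.mp hh)]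
  have hae : ∀ᵐ x ∂(volume : Measure (Eucl n)),
      ‖(cutoff n R f - ballAverage n R δ c f : L2 n) x‖ₑ ^ 2 ≤
      v⁻¹ * ∫⁻ h in Metric.ball (0 : Eucl n) (2 * δ), ‖f x - f (x + h)‖ₑ ^ 2 := by
    filter_upwards [Lp.coeFn_sub (cutoff n R f) (ballAverage n R δ c f),
      mulPotential_ae _ (memLp_indicator_ball n R) f, ballAverage_ae R δ c f] with x h1 h2 h3
    rw [h1, Pi.sub_apply, cutoff, h2, h3]
    by_cases hx : x ∈ Metric.ball (0 : Eucl n) R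
    · rw [Set.indicator_of_mem hx, Set.indicator_of_mem hx, one_mul]
      exact hpt x hx
    · rw [Set.indicator_of_notMem hx, Set.indicator_of_notMem hx]
      simp
  have hvol : volume (Metric.ball (0 : Eucl n) (2 * δ)) = 2 ^ n * v := by
    rw [Measure.addHaar_ball_mul_of_pos volume 0 two_pos δ, finrank_euclideanSpace_fin,
      ENNReal.ofReal_pow two_pos.le, ENNReal.ofReal_ofNat]
  have hfin : ‖cutoff n R f - ballAverage n R δ c f‖ₑ ^ 2 ≤
      2 ^ n * ENNReal.ofReal ((2 * δ * ‖grad n u‖) ^ 2) := by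
    rw [enorm_sq_eq_lintegral]
    calc _ ≤ ∫⁻ x, v⁻¹ * ∫⁻ h in Metric.ball (0 : Eucl n) (2 * δ), ‖f x - f (x + h)‖ₑ ^ 2 :=
          lintegral_mono_ae hae
      _ = v⁻¹ * ∫⁻ x, ∫⁻ h in Metric.ball (0 : Eucl n) (2 * δ), ‖f x - f (x + h)‖ₑ ^ 2 :=
          lintegral_const_mul' _ _ (ENNReal.inv_ne_top.mpr hv0)
      _ ≤ v⁻¹ * (2 ^ n * v * ENNReal.ofReal ((2 * δ * ‖grad n u‖) ^ 2)) := by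
          rw [← hvol]
          gcongr
          exact lintegral_ball_oscillation_le u
      _ = (v⁻¹ * v) * (2 ^ n * ENNReal.ofReal ((2 * δ * ‖grad n u‖) ^ 2)) := by ring
      _ = _ := by rw [ENNReal.inv_mul_cancel hv0 hvt, one_mul]
  rw [← ofReal_norm, ← ENNReal.ofReal_pow (norm_nonneg _)] at hfin
  have e2 : (2 ^ n * ENNReal.ofReal ((2 * δ * ‖grad n u‖) ^ 2) : ℝ≥0∞) =
      ENNReal.ofReal (2 ^ n * (2 * δ * ‖grad n u‖) ^ 2) := by
    rw [ENNReal.ofReal_mul (by positivity), ENNReal.ofReal_pow two_pos.le, ENNReal.ofReal_ofNat]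
  rw [e2] at hfin
  exact (ENNReal.ofReal_le_ofReal_iff (by positivity)).mp hfin

/-- The local Rellich theorem: the restriction `H¹(ℝⁿ) → L²(B_R)` is compact. -/
lemma isCompactOperator_cutoff_toL2 (n : ℕ) (R : ℝ) :
    IsCompactOperator ((cutoff n R).comp (toL2 n)) := by
  have hcl := isClosed_setOfPred_isCompactOperator (σ₁₂ := RingHom.id ℝ) (M₁ := H1 n)
    (M₂ := L2 n)
  refine hcl.closure_subset (Metric.mem_closure_iff.mpr fun ε hε => ?_)
  -- Estimating `√(2ⁿ)` by `2ⁿ`, the approximation error is at most `2ⁿ · 2δ = ε / 2` times the `H¹`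
  -- norm.
  set δ : ℝ := ε / (4 * 2 ^ n) with hδ
  have hδ0 : 0 < δ := by positivity
  obtain ⟨c, hc⟩ := exists_simpleFunc_dist_lt (n := n) R hδ0
  refine ⟨(ballAverage n R δ c).comp (toL2 n), (isCompactOperator_ballAverage n R δ c).comp_clm _,
    ?_⟩
  rw [dist_eq_norm]
  refine lt_of_le_of_lt (ContinuousLinearMap.opNorm_le_bound _ (half_pos hε).le fun u => ?_)
    (half_lt_self hε)
  have h1 := norm_cutoff_sub_ballAverage_le hδ0 hc u
  have h2 : ‖grad n u‖ ≤ ‖u‖ := by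
    have := norm_sq_H1 u
    exact le_of_sq_le_sq (by nlinarith [sq_nonneg ‖toL2 n u‖]) (norm_nonneg _)
  have h3 : (2 : ℝ) ^ n * (2 * δ * ‖grad n u‖) ^ 2 ≤ (ε / 2 * ‖u‖) ^ 2 := by
    have h4 : (2 : ℝ) ^ n * (2 * δ * ‖grad n u‖) ^ 2 ≤ (2 ^ n) ^ 2 * (2 * δ * ‖u‖) ^ 2 := by
      gcongr
      exact le_self_pow₀ (one_le_pow₀ one_le_two) two_ne_zero
    refine h4.trans (le_of_eq ?_)
    rw [hδ]
    field_simp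
    ring
  exact le_of_sq_le_sq (h1.trans h3) (by positivity)

/-- Multiplication by a bounded potential that vanishes at infinity is compact from `H¹` to
`L²`. -/
lemma isCompactOperator_mulPotential_toL2 {n : ℕ} {W : Eucl n → ℝ} (hW : MemLp W ∞ volume)
    (hvan : Tendsto W (cocompact (Eucl n)) (𝓝 0)) :
    IsCompactOperator ((mulPotential W hW).comp (toL2 n)) := by
  have hcl := isClosed_setOfPred_isCompactOperator (σ₁₂ := RingHom.id ℝ) (M₁ := H1 n)
    (M₂ := L2 n)
  refine hcl.closure_subset (Metric.mem_closure_iff.mpr fun ε hε => ?_)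
  obtain ⟨R, hR⟩ : ∃ R : ℝ, ∀ x ∉ Metric.ball (0 : Eucl n) R, ‖W x‖ ≤ ε / 2 := by
    have h1 : ∀ᶠ x in cocompact (Eucl n), ‖W x‖ < ε / 2 := by
      have := hvan.norm
      rw [norm_zero] at this
      exact this.eventually_lt_const (half_pos hε)
    obtain ⟨R, hR⟩ := Metric.closedBall_compl_subset_of_mem_cocompact h1 (0 : Eucl n)
    refine ⟨R + 1, fun x hx => le_of_lt (hR fun hxR => hx ?_)⟩
    exact Metric.closedBall_subset_ball (lt_add_one R) hxR
  -- The truncated operator is compact by Rellich and differs from the full one only where `|W| ≤ ε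
  -- / 2`; compact operators are closed in operator norm.
  refine ⟨(mulPotential W hW).comp ((cutoff n R).comp (toL2 n)),
    (isCompactOperator_cutoff_toL2 n R).clm_comp (mulPotential W hW), ?_⟩
  rw [dist_eq_norm]
  refine lt_of_le_of_lt (ContinuousLinearMap.opNorm_le_bound _ (half_pos hε).le fun u => ?_)
    (half_lt_self hε)
  have h2 : ‖toL2 n u‖ ≤ ‖u‖ := by
    have := norm_sq_H1 u
    exact le_of_sq_le_sq (by nlinarith [sq_nonneg ‖grad n u‖]) (norm_nonneg _)
  refine le_trans ?_ (mul_le_mul_of_nonneg_left h2 (half_pos hε).le)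
  refine Lp.norm_le_mul_norm_of_ae_le_mul ?_
  filter_upwards [Lp.coeFn_sub (mulPotential W hW (toL2 n u))
      (mulPotential W hW (cutoff n R (toL2 n u))), mulPotential_ae W hW (toL2 n u),
    mulPotential_ae W hW (cutoff n R (toL2 n u)),
    mulPotential_ae _ (memLp_indicator_ball n R) (toL2 n u)] with x h3 h4 h5 h6
  change ‖(mulPotential W hW (toL2 n u) - mulPotential W hW (cutoff n R (toL2 n u)) : L2 n) x‖ ≤ _
  rw [h3, Pi.sub_apply, h4, h5, cutoff, h6]
  by_cases hx : x ∈ Metric.ball (0 : Eucl n) R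
  · rw [Set.indicator_of_mem hx, one_mul, sub_self, norm_zero]
    positivity
  · rw [Set.indicator_of_notMem hx, zero_mul, mul_zero, sub_zero, norm_mul]
    gcongr
    exact hR x hx

end Rellich

/-! ### The operator `L` and its Rayleigh quotient -/

section PotentialOp

/-- Each isometry imposes an equality of two continuous maps. Closedness is what lets compactness
survive restricting the codomain to radial functions. -/
lemma isClosed_H1r (n : ℕ) : IsClosed (H1r n : Set (H1 n)) := by
  have : (H1r n : Set (H1 n)) = ⋂ R : Eucl n ≃ₗᵢ[ℝ] Eucl n,
      {u | Lp.compMeasurePreserving R R.measurePreserving (toL2 n u) = toL2 n u} := by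
    ext u
    simp only [Set.mem_iInter]
    refine forall_congr' fun R => ?_
    have h := Lp.coeFn_compMeasurePreserving (toL2 n u) R.measurePreserving
    exact ⟨fun hu => Lp.ext (h.trans hu), fun hu => h.symm.trans (by rw [hu])⟩
  rw [this]
  exact isClosed_iInter fun R => isClosed_eq
    ((Lp.isometry_compMeasurePreserving R.measurePreserving).continuous.comp (toL2 n).continuous)
    (toL2 n).continuous

lemma coe_potentialOp {n : ℕ} {lam : ℝ} (hlam : 0 < lam) {W : Eucl n → ℝ}
    (hW : MemLp W ∞ volume) (hr : IsRadial W) (φ : H1r n) :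
    (potentialOp n hlam W φ : H1 n) = resolvent n hlam (mulPotential W hW (toL2 n φ)) := by
  rw [potentialOp, dif_pos ⟨hW, hr⟩]
  rfl

lemma isCompactOperator_potentialOp {n : ℕ} {lam : ℝ} (hlam : 0 < lam) {W : Eucl n → ℝ}
    (hW : MemLp W ∞ volume) (hr : IsRadial W) (hvan : Tendsto W (cocompact (Eucl n)) (𝓝 0)) :
    IsCompactOperator (potentialOp n hlam W) := by
  rw [potentialOp, dif_pos ⟨hW, hr⟩]
  exact (((isCompactOperator_mulPotential_toL2 hW hvan).clm_comp (resolvent n hlam)).comp_clm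
    (H1r n).subtypeL).codRestrict _ (isClosed_H1r n)

/-- The energy form on `H¹ᵣ(ℝⁿ)`. -/
def radialEnergyForm (n : ℕ) (lam : ℝ) : H1r n →L[ℝ] H1r n →L[ℝ] ℝ :=
  (energyForm n lam).bilinearComp (H1r n).subtypeL (H1r n).subtypeL

lemma radialEnergyForm_apply {n : ℕ} {lam : ℝ} (u v : H1r n) :
    radialEnergyForm n lam u v = energyForm n lam u v := rfl

lemma radialEnergyForm_self {n : ℕ} {lam : ℝ} (u : H1r n) :
    radialEnergyForm n lam u u = ‖grad n u‖ ^ 2 + lam * ‖toL2 n u‖ ^ 2 := by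
  rw [radialEnergyForm_apply, energyForm_apply, real_inner_self_eq_norm_sq,
    real_inner_self_eq_norm_sq]

lemma radialEnergyForm_comm {n : ℕ} {lam : ℝ} (u v : H1r n) :
    radialEnergyForm n lam u v = radialEnergyForm n lam v u := by
  simp only [radialEnergyForm_apply, energyForm_apply, real_inner_comm]

lemma isCoercive_radialEnergyForm (n : ℕ) {lam : ℝ} (hlam : 0 < lam) :
    IsCoercive (radialEnergyForm n lam) := by
  obtain ⟨C, hC, h⟩ := isCoercive_energyForm n hlam
  exact ⟨C, hC, fun u => h u⟩

/-- The energy form cancels the resolvent. Symmetry of the operator and both Rayleigh bounds are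
read off from this integral. -/
lemma radialEnergyForm_potentialOp {n : ℕ} {lam : ℝ} (hlam : 0 < lam) {W : Eucl n → ℝ}
    (hW : MemLp W ∞ volume) (hr : IsRadial W) (u v : H1r n) :
    radialEnergyForm n lam (potentialOp n hlam W u) v =
      ∫ x, W x * (toL2 n u x * toL2 n v x) := by
  rw [radialEnergyForm_apply, coe_potentialOp hlam hW hr, energyForm_resolvent, L2.inner_def]
  refine integral_congr_ae ?_
  filter_upwards [mulPotential_ae W hW (toL2 n u)] with x hx
  rw [hx]
  simp
  ring

lemma radialEnergyForm_potentialOp_comm {n : ℕ} {lam : ℝ} (hlam : 0 < lam) {W : Eucl n → ℝ}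
    (hW : MemLp W ∞ volume) (hr : IsRadial W) (u v : H1r n) :
    radialEnergyForm n lam (potentialOp n hlam W u) v =
      radialEnergyForm n lam u (potentialOp n hlam W v) := by
  rw [radialEnergyForm_comm u, radialEnergyForm_potentialOp, radialEnergyForm_potentialOp]
  · simp only [mul_comm (toL2 n u _)]
  all_goals assumption

lemma integrable_mul_toL2 {n : ℕ} (f : L2 n) : Integrable fun x => f x * f x := by
  simpa [pow_two] using (Lp.memLp f).integrable_sq

lemma norm_sq_eq_integral {n : ℕ} (f : L2 n) : ‖f‖ ^ 2 = ∫ x, f x * f x := by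
  rw [← real_inner_self_eq_norm_sq, L2.inner_def]
  simp [pow_two]

lemma integrable_potential_mul {n : ℕ} {W : Eucl n → ℝ} (hW : MemLp W ∞ volume) (f : L2 n) :
    Integrable fun x => W x * (f x * f x) := by
  refine (integrable_mul_toL2 f).bdd_mul (c := (eLpNormEssSup W volume).toReal) hW.1 ?_
  have hfin : eLpNormEssSup W volume ≠ ⊤ := by
    rw [← eLpNorm_exponent_top]
    exact hW.2.ne
  filter_upwards [ae_le_eLpNormEssSup (f := W)] with x hx
  rw [← ofReal_norm] at hx
  exact (ENNReal.ofReal_le_iff_le_toReal hfin).mp hx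

/-- The Rayleigh quotient is at most `M / λ` if `W ≤ M`. -/
lemma radialEnergyForm_potentialOp_le {n : ℕ} {lam : ℝ} (hlam : 0 < lam) {W : Eucl n → ℝ}
    (hW : MemLp W ∞ volume) (hr : IsRadial W) {M : ℝ} (hM0 : 0 ≤ M)
    (hM : ∀ᵐ x, W x ≤ M) (u : H1r n) :
    radialEnergyForm n lam (potentialOp n hlam W u) u ≤ M / lam * radialEnergyForm n lam u u := by
  rw [radialEnergyForm_potentialOp hlam hW hr, radialEnergyForm_self]
  have h1 : ∫ x, W x * (toL2 n u x * toL2 n u x) ≤ M * ‖toL2 n (u : H1 n)‖ ^ 2 := by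
    rw [norm_sq_eq_integral, ← integral_const_mul]
    refine integral_mono_ae (integrable_potential_mul hW _)
      ((integrable_mul_toL2 _).const_mul M) ?_
    filter_upwards [hM] with x hx
    exact mul_le_mul_of_nonneg_right hx (mul_self_nonneg _)
  refine h1.trans ?_
  rw [mul_add, ← mul_assoc (M / lam), div_mul_cancel₀ _ hlam.ne']
  exact le_add_of_nonneg_left (by positivity)

/-- The Rayleigh quotient is at least `m / (λ + ε)` on functions that are concentrated where
`W ≥ m` and have a small gradient. -/
lemma le_radialEnergyForm_potentialOp {n : ℕ} {lam : ℝ} (hlam : 0 < lam) {W : Eucl n → ℝ}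
    (hW : MemLp W ∞ volume) (hr : IsRadial W) {m ε : ℝ} (hm : 0 ≤ m) (hε : 0 ≤ ε) (u : H1r n)
    (hmW : ∀ᵐ x, toL2 n u x ≠ 0 → m ≤ W x)
    (hu : ‖grad n u‖ ^ 2 ≤ ε * ‖toL2 n (u : H1 n)‖ ^ 2) :
    m / (lam + ε) * radialEnergyForm n lam u u ≤
      radialEnergyForm n lam (potentialOp n hlam W u) u := by
  rw [radialEnergyForm_potentialOp hlam hW hr, radialEnergyForm_self]
  have h1 : m * ‖toL2 n (u : H1 n)‖ ^ 2 ≤ ∫ x, W x * (toL2 n u x * toL2 n u x) := by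
    rw [norm_sq_eq_integral, ← integral_const_mul]
    refine integral_mono_ae ((integrable_mul_toL2 _).const_mul m)
      (integrable_potential_mul hW _) ?_
    filter_upwards [hmW] with x hx
    by_cases h0 : toL2 n u x = 0
    · simp [h0]
    · exact mul_le_mul_of_nonneg_right (hx h0) (mul_self_nonneg _)
  refine le_trans ?_ h1
  have h2 : 0 < lam + ε := by linarith
  rw [div_mul_eq_mul_div, div_le_iff₀ h2, mul_assoc]
  gcongr
  linarith

end PotentialOp

/-! ### Radial test functions with small Dirichlet energy -/

section TestFunctions

lemma continuous_gradient {n : ℕ} {φ : Eucl n → ℝ} (h : ContDiff ℝ ∞ φ) :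
    Continuous (gradient φ) :=
  (InnerProductSpace.toDual ℝ (Eucl n)).symm.continuous.comp (h.continuous_fderiv (by simp))

lemma hasCompactSupport_gradient {n : ℕ} {φ : Eucl n → ℝ} (hc : HasCompactSupport φ) :
    HasCompactSupport (gradient φ) :=
  (hc.fderiv ℝ).comp_left (g := (InnerProductSpace.toDual ℝ (Eucl n)).symm) (map_zero _)

lemma isWeakGradient_gradient {n : ℕ} {φ : Eucl n → ℝ} (h : ContDiff ℝ ∞ φ)
    (hc : HasCompactSupport φ) : IsWeakGradient φ (gradient φ) := by
  intro ψ hψ hψc v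
  have hd : Continuous fun x => fderiv ℝ φ x v :=
    (h.continuous_fderiv (by simp)).clm_apply continuous_const
  have hψd : Continuous fun x => fderiv ℝ ψ x v :=
    (hψ.continuous_fderiv (by simp)).clm_apply continuous_const
  simp only [inner_gradient_left]
  exact integral_mul_fderiv_eq_neg_fderiv_mul_of_integrable
    ((hd.mul hψ.continuous).integrable_of_hasCompactSupport hψc.mul_left)
    ((h.continuous.mul hψd).integrable_of_hasCompactSupport hc.mul_right)
    ((h.continuous.mul hψ.continuous).integrable_of_hasCompactSupport hc.mul_right)
    (fun x _ => h.differentiable (by simp) x) (fun x _ => hψ.differentiable (by simp) x)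

/-- Smooth compactly supported radial functions belong to `H¹ᵣ`, with the classical gradient. -/
lemma exists_H1r_of_contDiff {n : ℕ} {φ : Eucl n → ℝ} (h : ContDiff ℝ ∞ φ)
    (hc : HasCompactSupport φ) (hr : IsRadial φ) :
    ∃ w : H1r n, toL2 n w =ᵐ[volume] φ ∧ grad n w =ᵐ[volume] gradient φ := by
  have h1 : MemLp φ 2 (volume : Measure (Eucl n)) := h.continuous.memLp_of_hasCompactSupport hc
  have h2 : MemLp (gradient φ) 2 (volume : Measure (Eucl n)) :=
    (continuous_gradient h).memLp_of_hasCompactSupport (hasCompactSupport_gradient hc)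
  have hw : IsWeakGradient (h1.toLp φ) (h2.toLp (gradient φ)) := by
    intro ψ hψ hψc v
    have e1 : ∫ x, h1.toLp φ x * fderiv ℝ ψ x v = ∫ x, φ x * fderiv ℝ ψ x v := by
      refine integral_congr_ae ?_
      filter_upwards [h1.coeFn_toLp] with x hx
      rw [hx]
    have e2 : ∫ x, ⟪h2.toLp (gradient φ) x, v⟫ * ψ x = ∫ x, ⟪gradient φ x, v⟫ * ψ x := by
      refine integral_congr_ae ?_
      filter_upwards [h2.coeFn_toLp] with x hx
      rw [hx]
    rw [e1, e2]
    exact isWeakGradient_gradient h hc ψ hψ hψc v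
  obtain ⟨w, hw1, hw2⟩ := exists_H1_of_isWeakGradient _ _ hw
  have hφ : toL2 n w =ᵐ[volume] φ := by rw [hw1]; exact h1.coeFn_toLp
  refine ⟨⟨w, fun R => ?_⟩, hφ, by rw [hw2]; exact h2.coeFn_toLp⟩
  filter_upwards [hφ, R.measurePreserving.quasiMeasurePreserving.ae_eq_comp hφ] with x hx1 hx2
  rw [hx2, hx1, Function.comp_apply]
  exact hr _ _ (R.norm_map x)

/-- A smooth bump function of `|x|²`, supported where `1 ≤ |x|² ≤ 3`. -/
def sqBump : ContDiffBump (2 : ℝ) := ⟨1 / 2, 1, by norm_num, by norm_num⟩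

/-- A smooth radial function supported in an annulus. -/
def annularBump (n : ℕ) (x : Eucl n) : ℝ := sqBump (‖x‖ ^ 2)

/-- Composing with `|x|²` rather than `|x|` avoids any singularity at the origin. -/
lemma contDiff_annularBump (n : ℕ) : ContDiff ℝ ∞ (annularBump n) :=
  sqBump.contDiff.comp (contDiff_norm_sq ℝ)

lemma tsupport_annularBump_subset (n : ℕ) :
    tsupport (annularBump n) ⊆ {x | 1 ≤ ‖x‖ ^ 2 ∧ ‖x‖ ^ 2 ≤ 3} := by
  refine closure_minimal (fun x hx => ?_) ?_
  · have h1 : ‖x‖ ^ 2 ∈ Function.support sqBump := hx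
    rw [sqBump.support_eq, Real.ball_eq_Ioo] at h1
    obtain ⟨h2, h3⟩ := h1
    simp only [sqBump] at h2 h3
    exact ⟨by linarith, by linarith⟩
  · exact (isClosed_le continuous_const (continuous_norm.pow 2)).inter
      (isClosed_le (continuous_norm.pow 2) continuous_const)

lemma hasCompactSupport_annularBump (n : ℕ) : HasCompactSupport (annularBump n) := by
  refine (isCompact_closedBall (0 : Eucl n) 2).of_isClosed_subset (isClosed_tsupport _)
    fun x hx => ?_
  have := (tsupport_annularBump_subset n hx).2
  rw [mem_closedBall_zero_iff]
  nlinarith [norm_nonneg x]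

lemma integral_annularBump_sq_pos {n : ℕ} (hn : 1 ≤ n) : 0 < ∫ x, annularBump n x ^ 2 := by
  have hcont : Continuous fun x => annularBump n x ^ 2 := (contDiff_annularBump n).continuous.pow 2
  refine hcont.integral_pos_of_hasCompactSupport_nonneg_nonzero (x := ?_) ?_
    (fun x => by positivity) ?_
  -- A point with `|x|² = 2`, the centre of the bump; it exists because `n ≥ 1`.
  · exact EuclideanSpace.single ⟨0, hn⟩ (Real.sqrt 2)
  · exact (hasCompactSupport_annularBump n).comp_left (g := fun t : ℝ => t ^ 2) (by norm_num)
  · have : ‖(EuclideanSpace.single ⟨0, hn⟩ (Real.sqrt 2) : Eucl n)‖ ^ 2 = 2 := by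
      rw [PiLp.norm_single, Real.norm_eq_abs, sq_abs, Real.sq_sqrt two_pos.le]
    rw [annularBump, this, sqBump.eventuallyEq_one.eq_of_nhds]
    norm_num

lemma norm_sq_Lp_eq_integral {α F : Type*} [MeasurableSpace α] [NormedAddCommGroup F]
    [InnerProductSpace ℝ F] {μ : Measure α} (f : Lp F 2 μ) : ‖f‖ ^ 2 = ∫ x, ‖f x‖ ^ 2 ∂μ := by
  rw [← real_inner_self_eq_norm_sq, L2.inner_def]
  simp only [real_inner_self_eq_norm_sq]

lemma gradient_comp_smul {n : ℕ} (φ : Eucl n → ℝ) (r : ℝ) (x : Eucl n) :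
    gradient (fun y => φ (r • y)) x = r • gradient φ (r • x) := by
  rw [gradient, gradient, fderiv_comp_smul, map_smul]

lemma gradient_eq_zero_of_notMem_tsupport {n : ℕ} {φ : Eucl n → ℝ} {x : Eucl n}
    (hx : x ∉ tsupport φ) : gradient φ x = 0 := by
  rw [gradient, fderiv_of_notMem_tsupport (𝕜 := ℝ) hx, map_zero]

/-- Dilates of the annular bump, as elements of `H¹ᵣ`. -/
lemma exists_dilated_annularBump (n : ℕ) {r : ℝ} (hr : 0 < r) :
    ∃ w : H1r n, toL2 n w =ᵐ[volume] (fun x => annularBump n (r • x)) ∧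
      grad n w =ᵐ[volume] (fun x => r • gradient (annularBump n) (r • x)) ∧
      ‖toL2 n (w : H1 n)‖ ^ 2 = (r ^ n)⁻¹ * ∫ x, annularBump n x ^ 2 ∧
      ‖grad n (w : H1 n)‖ ^ 2 =
        r ^ 2 * ((r ^ n)⁻¹ * ∫ x, ‖gradient (annularBump n) x‖ ^ 2) := by
  obtain ⟨w, h1, h2⟩ := exists_H1r_of_contDiff (φ := fun x => annularBump n (r • x))
    ((contDiff_annularBump n).comp (contDiff_const_smul r))
    ((hasCompactSupport_annularBump n).comp_homeomorph (Homeomorph.smulOfNeZero r hr.ne'))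
    (fun x y hxy => by simp only [annularBump, norm_smul, hxy])
  have h2' : grad n w =ᵐ[volume] fun x => r • gradient (annularBump n) (r • x) :=
    h2.trans (Eventually.of_forall fun x => gradient_comp_smul _ r x)
  have habs : |(r ^ n)⁻¹| = (r ^ n)⁻¹ := abs_of_nonneg (by positivity)
  refine ⟨w, h1, h2', ?_, ?_⟩
  · have e : ∫ x, ‖toL2 n w x‖ ^ 2 = ∫ x, annularBump n (r • x) ^ 2 := by
      refine integral_congr_ae ?_
      filter_upwards [h1] with x hx
      rw [hx, Real.norm_eq_abs, sq_abs]
    rw [norm_sq_Lp_eq_integral, e,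
      Measure.integral_comp_smul volume (fun x => annularBump n x ^ 2) r,
      finrank_euclideanSpace_fin, habs, smul_eq_mul]
  · have e : ∫ x, ‖grad n w x‖ ^ 2 = ∫ x, r ^ 2 * ‖gradient (annularBump n) (r • x)‖ ^ 2 := by
      refine integral_congr_ae ?_
      filter_upwards [h2'] with x hx
      rw [hx, norm_smul, mul_pow, Real.norm_eq_abs, sq_abs]
    rw [norm_sq_Lp_eq_integral, e, integral_const_mul,
      Measure.integral_comp_smul volume (fun x => ‖gradient (annularBump n) x‖ ^ 2) r,
      finrank_euclideanSpace_fin, habs, smul_eq_mul]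

/-- The annuli dilated by different powers of two are disjoint. -/
lemma disjoint_dyadic_annuli {n : ℕ} {r : ℝ} (hr : 0 < r) {i j : ℕ} (hij : i ≠ j) (x : Eucl n)
    (hi : (r / 2 ^ i) • x ∈ tsupport (annularBump n))
    (hj : (r / 2 ^ j) • x ∈ tsupport (annularBump n)) : False := by
  wlog hlt : i < j generalizing i j
  · exact this hij.symm hj hi (lt_of_le_of_ne (not_lt.mp hlt) hij.symm)
  have h1 := (tsupport_annularBump_subset n hi).2
  have h2 := (tsupport_annularBump_subset n hj).1
  rw [norm_smul, mul_pow, Real.norm_eq_abs, sq_abs] at h1 h2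
  have h3 : r / 2 ^ j ≤ r / 2 ^ i / 2 := by
    rw [div_div, ← pow_succ]
    exact div_le_div_of_nonneg_left hr.le (by positivity) (pow_le_pow_right₀ one_le_two hlt)
  have h4 : (r / 2 ^ j) ^ 2 ≤ (r / 2 ^ i / 2) ^ 2 := pow_le_pow_left₀ (by positivity) h3 2
  -- The squared scales differ by a factor of at least `4`, while `|x|²` varies only by a factor of
  -- `3` on the annulus: one would get `1 ≤ 3/4`.
  nlinarith [mul_le_mul_of_nonneg_right h4 (sq_nonneg ‖x‖)]

lemma norm_sq_sum_smul_of_orthogonal {E ι : Type*} [NormedAddCommGroup E] [InnerProductSpace ℝ E]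
    [Fintype ι] {f : ι → E} (hf : ∀ i j, i ≠ j → ⟪f i, f j⟫ = 0) (c : ι → ℝ) :
    ‖∑ i, c i • f i‖ ^ 2 = ∑ i, c i ^ 2 * ‖f i‖ ^ 2 := by
  rw [← real_inner_self_eq_norm_sq, sum_inner]
  refine Finset.sum_congr rfl fun i _ => ?_
  rw [inner_sum, Finset.sum_eq_single i]
  · rw [real_inner_smul_left, real_inner_smul_right, real_inner_self_eq_norm_sq]
    ring
  · intro j _ hj
    rw [real_inner_smul_left, real_inner_smul_right, hf i j hj.symm]
    simp
  · simp

lemma inner_eq_zero_of_ae {α F : Type*} [MeasurableSpace α] [NormedAddCommGroup F]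
    [InnerProductSpace ℝ F] {μ : Measure α} {f g : Lp F 2 μ}
    (h : ∀ᵐ x ∂μ, f x = 0 ∨ g x = 0) : ⟪f, g⟫ = 0 := by
  rw [L2.inner_def]
  refine integral_eq_zero_of_ae ?_
  filter_upwards [h] with x hx
  rcases hx with hx | hx <;> simp [hx]

/-- There are finite-dimensional spaces of compactly supported radial functions of any given
dimension on which the Dirichlet energy is arbitrarily small. -/
lemma exists_radial_subspace {n : ℕ} (hn : 1 ≤ n) (N : ℕ) {ε : ℝ} (hε : 0 < ε) :
    ∃ (L : (Fin N → ℝ) →ₗ[ℝ] H1r n) (R : ℝ), Function.Injective L ∧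
      (∀ c, ‖grad n (L c : H1 n)‖ ^ 2 ≤ ε * ‖toL2 n (L c : H1 n)‖ ^ 2) ∧
      ∀ c, ∀ᵐ x, toL2 n (L c : H1 n) x ≠ 0 → x ∈ Metric.closedBall (0 : Eucl n) R := by
  set A := ∫ x, annularBump n x ^ 2 with hA
  set B := ∫ x, ‖gradient (annularBump n) x‖ ^ 2 with hB
  have hA0 : 0 < A := integral_annularBump_sq_pos hn
  have hB0 : 0 ≤ B := integral_nonneg fun x => by positivity
  -- Dilating by `r` multiplies the ratio of Dirichlet energy to mass by `r²`, so this makes it at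
  -- most `ε`. The `B + 1` in the witness keeps the denominator positive without knowing `B > 0`.
  obtain ⟨r, hr0, hrB⟩ : ∃ r : ℝ, 0 < r ∧ r ^ 2 * B ≤ ε * A := by
    refine ⟨Real.sqrt (ε * A / (B + 1)), Real.sqrt_pos.mpr (by positivity), ?_⟩
    rw [Real.sq_sqrt (by positivity), div_mul_eq_mul_div, div_le_iff₀ (by positivity)]
    gcongr
    linarith
  have hri : ∀ i : Fin N, 0 < r / 2 ^ (i : ℕ) := fun i => by positivity
  choose w hw1 hw2 hw3 hw4 using fun i : Fin N => exists_dilated_annularBump n (hri i)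
  have hw0 : ∀ i, 0 < ‖toL2 n (w i : H1 n)‖ ^ 2 := fun i => by
    rw [hw3]
    have := hri i
    positivity
  have horth : ∀ i j, i ≠ j → ⟪toL2 n (w i : H1 n), toL2 n (w j : H1 n)⟫ = 0 := by
    intro i j hij
    refine inner_eq_zero_of_ae ?_
    filter_upwards [hw1 i, hw1 j] with x hx hx'
    rw [hx, hx']
    by_contra! h
    exact disjoint_dyadic_annuli hr0 (fun h => hij (Fin.ext h)) x (subset_tsupport _ h.1)
      (subset_tsupport _ h.2)
  have horth' : ∀ i j, i ≠ j → ⟪grad n (w i : H1 n), grad n (w j : H1 n)⟫ = 0 := by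
    intro i j hij
    refine inner_eq_zero_of_ae ?_
    filter_upwards [hw2 i, hw2 j] with x hx hx'
    rw [hx, hx']
    by_contra! h
    -- Gradients vanish off the topological support, hence the disjointness is needed for closed
    -- supports.
    refine disjoint_dyadic_annuli hr0 (fun h => hij (Fin.ext h)) x (of_not_not fun h' => h.1 ?_)
      (of_not_not fun h' => h.2 ?_)
    · rw [gradient_eq_zero_of_notMem_tsupport h', smul_zero]
    · rw [gradient_eq_zero_of_notMem_tsupport h', smul_zero]
  have hL : ∀ c : Fin N → ℝ, ((Fintype.linearCombination ℝ w c : H1r n) : H1 n) =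
      ∑ i, c i • (w i : H1 n) := by
    intro c
    rw [Fintype.linearCombination_apply]
    simp
  have hL1 : ∀ c : Fin N → ℝ, toL2 n ((Fintype.linearCombination ℝ w c : H1r n) : H1 n) =
      ∑ i, c i • toL2 n (w i : H1 n) := fun c => by
    rw [hL, map_sum]
    simp only [map_smul]
  have hL2 : ∀ c : Fin N → ℝ, grad n ((Fintype.linearCombination ℝ w c : H1r n) : H1 n) =
      ∑ i, c i • grad n (w i : H1 n) := fun c => by
    rw [hL, map_sum]
    simp only [map_smul]
  -- The `i`-th dilate lives where `(r / 2^i)|x| ≤ √3 < 2`, and `i < N`, which gives the common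
  -- radius.
  refine ⟨Fintype.linearCombination ℝ w, 2 ^ N * 2 / r, ?_, fun c => ?_, fun c => ?_⟩
  · rw [injective_iff_map_eq_zero]
    intro c hc
    have h1 := hL1 c
    rw [hc, ZeroMemClass.coe_zero, map_zero] at h1
    have h2 := norm_sq_sum_smul_of_orthogonal horth c
    rw [← h1, norm_zero, zero_pow two_ne_zero, eq_comm,
      Finset.sum_eq_zero_iff_of_nonneg (fun i _ => by positivity)] at h2
    ext i
    have h3 := h2 i (Finset.mem_univ i)
    exact pow_eq_zero_iff two_ne_zero |>.mp ((mul_eq_zero.mp h3).resolve_right (hw0 i).ne')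
  -- Orthogonality of functions and of gradients reduces the inequality to each dilate separately;
  -- the scales `r / 2^i` are at most `r`, so each one satisfies it.
  · rw [hL1, hL2, norm_sq_sum_smul_of_orthogonal horth, norm_sq_sum_smul_of_orthogonal horth',
      Finset.mul_sum]
    refine Finset.sum_le_sum fun i _ => ?_
    rw [mul_left_comm]
    refine mul_le_mul_of_nonneg_left ?_ (sq_nonneg _)
    rw [hw3, hw4]
    have h1 : (r / 2 ^ (i : ℕ)) ^ 2 ≤ r ^ 2 :=
      pow_le_pow_left₀ (hri i).le (div_le_self hr0.le (one_le_pow₀ one_le_two)) 2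
    have h2 : (r / 2 ^ (i : ℕ)) ^ 2 * B ≤ ε * A := (mul_le_mul_of_nonneg_right h1 hB0).trans hrB
    have h3 : 0 ≤ ((r / 2 ^ (i : ℕ)) ^ n)⁻¹ := inv_nonneg.mpr (pow_nonneg (hri i).le n)
    nlinarith [mul_le_mul_of_nonneg_left h2 h3]
  · rw [hL1]
    have hall : ∀ᵐ x ∂(volume : Measure (Eucl n)), ∀ i : Fin N,
        toL2 n (w i : H1 n) x = annularBump n ((r / 2 ^ (i : ℕ)) • x) ∧
        (c i • toL2 n (w i : H1 n) : L2 n) x = c i * toL2 n (w i : H1 n) x := by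
      refine eventually_all.mpr fun i => ?_
      filter_upwards [hw1 i, Lp.coeFn_smul (c i) (toL2 n (w i : H1 n))] with x h1 h2
      exact ⟨h1, h2⟩
    filter_upwards [hall, Lp.coeFn_finsetSum Finset.univ fun i => c i • toL2 n (w i : H1 n)]
      with x hx hs hne
    rw [hs, Finset.sum_apply] at hne
    obtain ⟨i, -, hi⟩ := Finset.exists_ne_zero_of_sum_ne_zero hne
    rw [(hx i).2, (hx i).1] at hi
    have h1 := (tsupport_annularBump_subset n (subset_tsupport _ (right_ne_zero_of_mul hi))).2
    rw [norm_smul, Real.norm_eq_abs, abs_of_pos (hri i)] at h1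
    have h2 : r / 2 ^ (i : ℕ) * ‖x‖ ≤ 2 := by
      have := mul_nonneg (hri i).le (norm_nonneg x)
      nlinarith
    rw [mem_closedBall_zero_iff, le_div_iff₀ hr0]
    have h3 : (2 : ℝ) ^ (i : ℕ) ≤ 2 ^ N := pow_le_pow_right₀ one_le_two i.2.le
    have h4 : r * ‖x‖ ≤ 2 ^ (i : ℕ) * 2 := by
      rw [div_mul_eq_mul_div, div_le_iff₀ (by positivity)] at h2
      linarith
    linarith [mul_le_mul_of_nonneg_right h3 (zero_le_two (α := ℝ))]

end TestFunctions

/-! ### Eigenvalue bounds and the limit -/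

/-- Two-sided bound for the `k`-th eigenvalue of a potential operator whose potential is between
`κ - ε` and `κ + ε` on the relevant sets. -/
lemma kthEigenvalue_potentialOp_mem_Icc {n : ℕ} {lam kap ε R : ℝ} (hlam : 0 < lam) (hε : 0 < ε)
    (hεk : ε < kap) {W : Eucl n → ℝ} (hW : MemLp W ∞ volume) (hr : IsRadial W)
    (hvan : Tendsto W (cocompact (Eucl n)) (𝓝 0)) (hM : ∀ᵐ x, W x ≤ kap + ε)
    (hm : ∀ x ∈ Metric.closedBall (0 : Eucl n) R, kap - ε ≤ W x) {k : ℕ}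
    {L : (Fin (k + 1) → ℝ) →ₗ[ℝ] H1r n} (hL : Function.Injective L)
    (hLε : ∀ c, ‖grad n (L c : H1 n)‖ ^ 2 ≤ ε * ‖toL2 n (L c : H1 n)‖ ^ 2)
    (hLR : ∀ c, ∀ᵐ x, toL2 n (L c : H1 n) x ≠ 0 → x ∈ Metric.closedBall (0 : Eucl n) R) :
    kthEigenvalue (potentialOp n hlam W : Module.End ℝ (H1r n)) k ∈
      Set.Icc ((kap - ε) / (lam + ε)) ((kap + ε) / lam) := by
  refine kthEigenvalue_mem_Icc (isCoercive_radialEnergyForm n hlam) radialEnergyForm_comm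
    (isCompactOperator_potentialOp hlam hW hr hvan) (radialEnergyForm_potentialOp_comm hlam hW hr)
    (div_pos (by linarith) (by linarith)) L hL (fun c => ?_)
    (radialEnergyForm_potentialOp_le hlam hW hr (by linarith) hM)
  refine le_radialEnergyForm_potentialOp hlam hW hr (by linarith) hε.le (L c) ?_ (hLε c)
  filter_upwards [hLR c] with x hx h0
  exact hm x (hx h0)

end RadialSchrodinger

end

theorem mainTheorem8 (n : ℕ) (hn : 1 ≤ n) (kap lam a b : ℝ) (hkap : 0 < kap) (hlam : 0 < lam)
    (hab : a < b) (W : ℝ → EuclideanSpace ℝ (Fin n) → ℝ)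
    (hmeas : ∀ s ∈ Set.Ioo a b, AEStronglyMeasurable (W s) volume)
    (hrad : ∀ s ∈ Set.Ioo a b, RadialSchrodinger.IsRadial (W s))
    (hnonneg : ∀ s ∈ Set.Ioo a b, ∀ x, 0 ≤ W s x)
    (hvan : ∀ s ∈ Set.Ioo a b,
      Tendsto (W s) (cocompact (EuclideanSpace ℝ (Fin n))) (𝓝 0))
    (hsup : limsup (fun s => eLpNorm (W s) ∞ volume) (𝓝[<] b) = ENNReal.ofReal kap)
    (hloc : TendstoLocallyUniformly W (fun _ => kap) (𝓝[<] b)) (k : ℕ) :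
    Tendsto
      (fun s => RadialSchrodinger.kthEigenvalue
        (RadialSchrodinger.potentialOp n hlam (W s) : Module.End ℝ (RadialSchrodinger.H1r n)) k)
      (𝓝[<] b) (𝓝 (kap / lam)) := by
  have key : ∀ ε : ℝ, 0 < ε → ε < kap → ∀ᶠ s in 𝓝[<] b,
      RadialSchrodinger.kthEigenvalue
        (RadialSchrodinger.potentialOp n hlam (W s) : Module.End ℝ (RadialSchrodinger.H1r n)) k ∈
      Set.Icc ((kap - ε) / (lam + ε)) ((kap + ε) / lam) := by
    intro ε hε hεk
    -- The trial space and its radius depend only on `ε` and `k`, not on `s`, so locally uniform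
    -- convergence suffices on one fixed ball.
    obtain ⟨L, R, hL, hLε, hLR⟩ := RadialSchrodinger.exists_radial_subspace hn (k + 1) hε
    have h1 : ∀ᶠ s in 𝓝[<] b, eLpNorm (W s) ∞ volume < ENNReal.ofReal (kap + ε) := by
      refine eventually_lt_of_limsup_lt ?_
      rw [hsup]
      exact (ENNReal.ofReal_lt_ofReal_iff (by linarith)).mpr (by linarith)
    have h2 : ∀ᶠ s in 𝓝[<] b, ∀ x ∈ Metric.closedBall (0 : EuclideanSpace ℝ (Fin n)) R,
        dist kap (W s x) < ε := by
      have := (tendstoLocallyUniformlyOn_iff_tendstoUniformlyOn_of_compact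
        (isCompact_closedBall (0 : EuclideanSpace ℝ (Fin n)) R)).mp
        hloc.tendstoLocallyUniformlyOn
      exact Metric.tendstoUniformlyOn_iff.mp this ε hε
    filter_upwards [h1, h2, Ioo_mem_nhdsLT hab] with s hs1 hs2 hs
    -- The strict bound on the essential supremum places `W s` in `L^∞`, so `potentialOp` is the
    -- actual operator and not its default value `0`.
    refine RadialSchrodinger.kthEigenvalue_potentialOp_mem_Icc hlam hε hεk
      ⟨hmeas s hs, hs1.trans ENNReal.ofReal_lt_top⟩ (hrad s hs) (hvan s hs) ?_ (fun x hx => ?_)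
      hL hLε hLR
    · filter_upwards [ae_le_eLpNormEssSup (f := W s)] with x hx
      rw [← eLpNorm_exponent_top, Real.enorm_of_nonneg (hnonneg s hs x)] at hx
      exact (ENNReal.ofReal_le_ofReal_iff (by linarith)).mp (hx.trans hs1.le)
    · have := (abs_lt.mp (Real.dist_eq kap (W s x) ▸ hs2 x hx)).2
      linarith
  have hsmall : ∀ᶠ ε : ℝ in 𝓝[>] 0, 0 < ε ∧ ε < kap := by
    filter_upwards [Ioo_mem_nhdsGT hkap] with ε hε using hε
  have hlow : Tendsto (fun ε : ℝ => (kap - ε) / (lam + ε)) (𝓝[>] 0) (𝓝 (kap / lam)) := by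
    have : ContinuousAt (fun ε : ℝ => (kap - ε) / (lam + ε)) 0 := by
      refine ContinuousAt.div (by fun_prop) (by fun_prop) ?_
      simpa using hlam.ne'
    simpa using this.tendsto.mono_left nhdsWithin_le_nhds
  have hupp : Tendsto (fun ε : ℝ => (kap + ε) / lam) (𝓝[>] 0) (𝓝 (kap / lam)) := by
    have : ContinuousAt (fun ε : ℝ => (kap + ε) / lam) 0 := by fun_prop
    simpa using this.tendsto.mono_left nhdsWithin_le_nhds
  -- Both ends of the interval tend to `κ/λ` as `ε → 0⁺`, so for each strict bound a single small
  -- `ε` suffices.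
  refine tendsto_order.mpr ⟨fun α hα => ?_, fun β hβ => ?_⟩
  · obtain ⟨ε, ⟨h0, hk⟩, hlt⟩ := (hsmall.and (hlow.eventually_const_lt hα)).exists
    filter_upwards [key ε h0 hk] with s hs using hlt.trans_le hs.1
  · obtain ⟨ε, ⟨h0, hk⟩, hlt⟩ := (hsmall.and (hupp.eventually_lt_const hβ)).exists
    filter_upwards [key ε h0 hk] with s hs using hs.2.trans_lt hlt
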